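/- **Theorem (Convergence of the scheme).** Let $d\ge 1$, let $\Omega\subset\mathbb{R}^d$ be open, bounded and connected, and assume: * $\zeta:\mathbb{R}\to\mathbb{R}$ is continuous and non-decreasing, $\zeta(0)=0$ and, for some $M_0,M_1>0$, $|\zeta(s)|\ge M_0|s|-M_1$ for all $s\in\mathbb{R}$; * $\beta:\mathbb{R}\to\mathbb{R}$ is continuous and non-decreasing, $\beta(0)=0$ and, for some $K_0,K_1>0$, $|\beta(s)|\le K_0|s|+K_1$ for all $s\in\mathbb{R}$; * $\beta+\zeta$ is strictly increasing; * $\Lambda:\Omega\to\mathcal M_d(\mathbb{R})$ is measurable and there are $\overline\lambda\ge\underline\lambda>0$ such that, for a.e. $x\in\Omega$, $\Lambda(x)$ is symmetric with eigenvalues in $[\underline\lambda,\overline\lambda]$; * $f\in L^2(\Omega)$ and $F\in L^2(\Omega)^d$. A weak solution is a function $\overline u\in L^2(\Omega)$ such that $\zeta(\overline u)\in H^1_0(\Omega)$ and $$\int_\Omega \beta(\overline u)\,\overline v+\int_\Omega\Lambda\nabla\zeta(\overline u)\cdot\nabla\overline v=\int_\Omega f\,\overline v-\int_\Omega F\cdot\nabla\overline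 v\qquad\forall\,\overline v\in H^1_0(\Omega).$$ A gradient discretisation with piecewise constant reconstruction is $\mathcal D=(X_{\mathcal D,0},\Pi_{\mathcal D},\nabla_{\mathcal D},Q_{\mathcal D})$ where, for some finite sets $I$ and $I_{\partial\Omega}\subset I$, $X_{\mathcal D,0}=\{v=(v_i)_{i\in I}\in\mathbb{R}^I: v_i=0\ \forall i\in I_{\partial\Omega}\}$; $\Pi_{\mathcal D}:X_{\mathcal D,0}\to L^2(\Omega)$ and $\nabla_{\mathcal D}:X_{\mathcal D,0}\to L^2(\Omega)^d$ are linear; $\|v\|_{\mathcal D}:=\|\nabla_{\mathcal D}v\|_{L^2}$ is a norm on $X_{\mathcal D,0}$; $Q_{\mathcal D}:L^2(\Omega)\to L^2(\Omega)$ is an arbitrary map; and there is a partition $(U_i)_{i\in I}$ of $\Omega$ (some $U_i$ may be empty) with $\Pi_{\mathcal D}v=\sum_{i\in I}v_i\mathbf 1_{U_i}$ for all $v\in X_{\mathcal D,0}$. For $g:\mathbb{R}\to\mathbb{R}$ with $g(0)=0$ and $v\in X_{\mathcal D,0}$ set $g(v):=(g(v_i))_{i\in I}$. Define (with the convention $\max_\emptyset=0$)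 $$C_{\mathcal D}=\max_{v\ne 0}\frac{\|\Pi_{\mathcal D}v\|_{L^2}}{\|v\|_{\mathcal D}},\qquad S_{\mathcal D}(\varphi)=\min_{v\in X_{\mathcal D,0}}\big(\|\nabla_{\mathcal D}v-\nabla\varphi\|_{L^2}+\|\Pi_{\mathcal D}v-\varphi\|_{L^2}\big)\quad(\varphi\in H^1_0(\Omega)),$$ $$W_{\mathcal D}(\psi)=\max_{v\ne0}\frac1{\|v\|_{\mathcal D}}\Big|\int_\Omega\nabla_{\mathcal D}v\cdot\psi+\Pi_{\mathcal D}v\,\mathrm{div}\,\psi\Big|\quad(\psi\in H_{\mathrm{div}}(\Omega)).$$ Let $(\mathcal D_m)_{m\in\mathbb{N}}$ be a sequence of gradient discretisations with piecewise constant reconstructions such that: * (coercivity) $(C_{\mathcal D_m})_m$ is bounded; * (consistency) $S_{\mathcal D_m}(\varphi)\to0$ for all $\varphi\in H^1_0(\Omega)$, and $\|Q_{\mathcal D_m}f-f\|_{L^2}\to0$; * (limit-conformity) $W_{\mathcal D_m}(\psi)\to0$ for all $\psi\in H_{\mathrm{div}}(\Omega)$; * (compactness) for any $(v_m)_m$ with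 $v_m\in X_{\mathcal D_m,0}$ and $(\nabla_{\mathcal D_m}v_m)_m$ bounded in $L^2(\Omega)^d$, the set $\{\Pi_{\mathcal D_m}v_m:m\in\mathbb{N}\}$ is relatively compact in $L^2(\Omega)$. For every $m$, let $u_m\in X_{\mathcal D_m,0}$ be a solution of the scheme $$\int_\Omega\beta(\Pi_{\mathcal D_m}u_m)\Pi_{\mathcal D_m}v+\int_\Omega\Lambda\nabla_{\mathcal D_m}\zeta(u_m)\cdot\nabla_{\mathcal D_m}v=\int_\Omega Q_{\mathcal D_m}f\;\Pi_{\mathcal D_m}v-\int_\Omega F\cdot\nabla_{\mathcal D_m}v\qquad\forall v\in X_{\mathcal D_m,0}.$$ Then there is a unique weak solution $\overline u$ and, as $m\to\infty$, $\Pi_{\mathcal D_m}\zeta(u_m)\to\zeta(\overline u)$ strongly in $L^2(\Omega)$, $\nabla_{\mathcal D_m}\zeta(u_m)\to\nabla\zeta(\overline u)$ strongly in $L^2(\Omega)^d$, and $\Pi_{\mathcal D_m}\beta(u_m)\to\beta(\overline u)$ weakly in $L^2(\Omega)$. -/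

import Mathlib

open MeasureTheory Filter Topology
open scoped ContDiff Gradient

noncomputable section

namespace GradScheme

/-! ## Function spaces on an open set `Ω ⊆ ℝ^d` -/

/-- `ℝ^d` with its Euclidean norm. -/
abbrev Rd (d : ℕ) : Type := EuclideanSpace ℝ (Fin d)

/-- `L²(Ω)`. -/
abbrev L2 {d : ℕ} (Ω : Set (Rd d)) : Type :=
  Lp ℝ 2 (volume.restrict Ω)

/-- `L²(Ω)^d`. -/
abbrev L2Vec {d : ℕ} (Ω : Set (Rd d)) : Type :=
  Lp (Rd d) 2 (volume.restrict Ω)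

/-- `φ ∈ C_c^∞(Ω)`. -/
structure IsTestFunction {d : ℕ} (Ω : Set (Rd d)) (φ : Rd d → ℝ) : Prop where
  contDiff : ContDiff ℝ ∞ φ
  hasCompactSupport : HasCompactSupport φ
  tsupport_subset : tsupport φ ⊆ Ω

/-- The weak gradient of `u ∈ L²(Ω)` is `G ∈ L²(Ω)^d`. -/
def HasWeakGradient {d : ℕ} {Ω : Set (Rd d)} (u : L2 Ω) (G : L2Vec Ω) : Prop :=
  ∀ φ : Rd d → ℝ, IsTestFunction Ω φ →
    ∫ x in Ω, u x • (∇ φ x) = - ∫ x in Ω, φ x • G x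

/-- `ψ ∈ H_div(Ω)` with weak divergence `δ ∈ L²(Ω)`. -/
def HasWeakDivergence {d : ℕ} {Ω : Set (Rd d)} (ψ : L2Vec Ω) (δ : L2 Ω) : Prop :=
  ∀ φ : Rd d → ℝ, IsTestFunction Ω φ →
    ∫ x in Ω, inner ℝ (ψ x) (∇ φ x) = - ∫ x in Ω, δ x * φ x

lemma IsTestFunction.zero {d : ℕ} {Ω : Set (Rd d)} : IsTestFunction Ω (0 : Rd d → ℝ) where
  contDiff := contDiff_const
  hasCompactSupport := HasCompactSupport.zero
  tsupport_subset := by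
    simp [tsupport, Function.support_zero]

lemma IsTestFunction.add {d : ℕ} {Ω : Set (Rd d)} {φ χ : Rd d → ℝ}
    (hφ : IsTestFunction Ω φ) (hχ : IsTestFunction Ω χ) : IsTestFunction Ω (φ + χ) where
  contDiff := hφ.contDiff.add hχ.contDiff
  hasCompactSupport := hφ.hasCompactSupport.add hχ.hasCompactSupport
  tsupport_subset := (tsupport_add φ χ).trans
    (Set.union_subset hφ.tsupport_subset hχ.tsupport_subset)

lemma IsTestFunction.const_smul {d : ℕ} {Ω : Set (Rd d)} {φ : Rd d → ℝ}
    (hφ : IsTestFunction Ω φ) (c : ℝ) : IsTestFunction Ω (c • φ) where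
  contDiff := hφ.contDiff.const_smul c
  hasCompactSupport := hφ.hasCompactSupport.comp_left (g := fun y => c • y) (smul_zero c)
  tsupport_subset :=
    (closure_mono (Function.support_const_smul_subset c φ)).trans hφ.tsupport_subset

lemma IsTestFunction.differentiable {d : ℕ} {Ω : Set (Rd d)} {φ : Rd d → ℝ}
    (hφ : IsTestFunction Ω φ) : Differentiable ℝ φ :=
  hφ.contDiff.differentiable (by simp)

/-- The pairs `(φ, ∇φ)` with `φ ∈ C_c^∞(Ω)`. -/
def testPairs {d : ℕ} (Ω : Set (Rd d)) : Submodule ℝ (L2 Ω × L2Vec Ω) where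
  carrier := {p | ∃ φ : Rd d → ℝ, IsTestFunction Ω φ ∧
    (∀ᵐ x ∂(volume.restrict Ω), p.1 x = φ x) ∧
    (∀ᵐ x ∂(volume.restrict Ω), p.2 x = ∇ φ x)}
  zero_mem' := by
    refine ⟨0, IsTestFunction.zero, Lp.coeFn_zero _ _ _, ?_⟩
    filter_upwards [Lp.coeFn_zero (Rd d) 2 (volume.restrict Ω)] with x hx
    have h0 : ∇ (0 : Rd d → ℝ) x = 0 := by simp [gradient]
    rw [h0]
    exact hx
  add_mem' := by
    rintro p q ⟨φ, hφ, hp1, hp2⟩ ⟨χ, hχ, hq1, hq2⟩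
    refine ⟨φ + χ, hφ.add hχ, ?_, ?_⟩
    · filter_upwards [hp1, hq1, Lp.coeFn_add p.1 q.1] with x h1 h2 h3
      simp only [Prod.fst_add, h3, Pi.add_apply, h1, h2]
    · filter_upwards [hp2, hq2, Lp.coeFn_add p.2 q.2] with x h1 h2 h3
      simp only [Prod.snd_add, h3, Pi.add_apply, h1, h2, gradient]
      rw [fderiv_add hφ.differentiable.differentiableAt hχ.differentiable.differentiableAt,
        map_add]
  smul_mem' := by
    rintro c p ⟨φ, hφ, hp1, hp2⟩
    refine ⟨c • φ, hφ.const_smul c, ?_, ?_⟩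
    · filter_upwards [hp1, Lp.coeFn_smul c p.1] with x h1 h3
      simp only [Prod.smul_fst, h3, Pi.smul_apply, h1]
    · filter_upwards [hp2, Lp.coeFn_smul c p.2] with x h1 h3
      simp only [Prod.smul_snd, h3, Pi.smul_apply, h1, gradient]
      rw [fderiv_const_smul hφ.differentiable.differentiableAt]
      simp

/-- The space `H¹₀(Ω)`, the closure of `C_c^∞(Ω)` in `H¹(Ω)`, each of its elements `u` being
recorded together with its (unique, see `H10.hasWeakGradient` and `H10.gradient_unique`) weak
gradient, as the pair `(u, ∇u) ∈ L²(Ω) × L²(Ω)^d`. -/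
def H10 {d : ℕ} (Ω : Set (Rd d)) : Submodule ℝ (L2 Ω × L2Vec Ω) :=
  (testPairs Ω).topologicalClosure

lemma IsTestFunction.continuous_gradient {d : ℕ} {Ω : Set (Rd d)} {φ : Rd d → ℝ}
    (hφ : IsTestFunction Ω φ) : Continuous (fun x => ∇ φ x) := by
  have h := hφ.contDiff.continuous_fderiv (by simp)
  exact (InnerProductSpace.toDual ℝ (Rd d)).symm.continuous.comp h

lemma IsTestFunction.hasCompactSupport_gradient {d : ℕ} {Ω : Set (Rd d)} {φ : Rd d → ℝ}
    (hφ : IsTestFunction Ω φ) : HasCompactSupport (fun x => ∇ φ x) := by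
  have h := hφ.hasCompactSupport.fderiv (𝕜 := ℝ)
  exact h.comp_left (g := (InnerProductSpace.toDual ℝ (Rd d)).symm) (map_zero _)

/-- Elements of `H10 Ω` are pairs made of a function and its weak gradient. -/
theorem H10.hasWeakGradient {d : ℕ} {Ω : Set (Rd d)} {p : L2 Ω × L2Vec Ω} (hp : p ∈ H10 Ω) :
    HasWeakGradient p.1 p.2 := by
  intro φ hφ
  have hφ2 : MemLp φ 2 (volume.restrict Ω) :=
    hφ.contDiff.continuous.memLp_of_hasCompactSupport hφ.hasCompactSupport
  have hgφ2 : MemLp (fun x => ∇ φ x) 2 (volume.restrict Ω) :=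
    hφ.continuous_gradient.memLp_of_hasCompactSupport hφ.hasCompactSupport_gradient
  have hi1 : ∀ u : L2 Ω, Integrable (fun x => u x • ∇ φ x) (volume.restrict Ω) :=
    fun u => memLp_one_iff_integrable.1 (hgφ2.smul (p := 2) (q := 2) (r := 1) (Lp.memLp u))
  have hi2 : ∀ G : L2Vec Ω, Integrable (fun x => φ x • G x) (volume.restrict Ω) :=
    fun G => memLp_one_iff_integrable.1 ((Lp.memLp G).smul (p := 2) (q := 2) (r := 1) hφ2)
  refine ext_inner_right ℝ fun e => ?_
  rw [inner_neg_left, real_inner_comm, real_inner_comm e (∫ x in Ω, φ x • p.2 x),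
    ← integral_inner (hi1 _), ← integral_inner (hi2 _)]
  have hA2 : MemLp (fun x => inner ℝ e (∇ φ x)) 2 (volume.restrict Ω) := hgφ2.const_inner e
  have hB2 : MemLp (fun x => φ x • e) 2 (volume.restrict Ω) := by
    refine (Continuous.memLp_of_hasCompactSupport ?_ ?_)
    · exact hφ.contDiff.continuous.smul continuous_const
    · exact hφ.hasCompactSupport.smul_right
  have hA : ∀ u : L2 Ω, ∫ x in Ω, inner ℝ e (u x • ∇ φ x) = inner ℝ (hA2.toLp _) u := by
    intro u
    rw [L2.inner_def]
    refine integral_congr_ae ?_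
    filter_upwards [hA2.coeFn_toLp] with x hx
    rw [hx, inner_smul_right]
    simp
  have hB : ∀ G : L2Vec Ω, ∫ x in Ω, inner ℝ e (φ x • G x) = inner ℝ (hB2.toLp _) G := by
    intro G
    rw [L2.inner_def]
    refine integral_congr_ae ?_
    filter_upwards [hB2.coeFn_toLp] with x hx
    rw [hx, inner_smul_right, real_inner_smul_left]
  rw [hA, hB]
  have hcl : IsClosed {q : L2 Ω × L2Vec Ω |
      inner ℝ (hA2.toLp _) q.1 = - inner ℝ (hB2.toLp _) q.2} := by
    refine isClosed_eq ?_ ?_ <;> fun_prop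
  refine closure_minimal (s := (testPairs Ω : Set (L2 Ω × L2Vec Ω))) ?_ hcl hp
  rintro q ⟨χ, hχ, hq1, hq2⟩
  show inner ℝ (hA2.toLp _) q.1 = - inner ℝ (hB2.toLp _) q.2
  rw [← hA, ← hB]
  have e1 : ∫ x in Ω, inner ℝ e (q.1 x • ∇ φ x) = ∫ x in Ω, χ x * fderiv ℝ φ x e := by
    refine integral_congr_ae ?_
    filter_upwards [hq1] with x hx
    rw [hx, inner_smul_right, real_inner_comm, inner_gradient_left]
  have e2 : ∫ x in Ω, inner ℝ e (φ x • q.2 x) = ∫ x in Ω, fderiv ℝ χ x e * φ x := by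
    refine integral_congr_ae ?_
    filter_upwards [hq2] with x hx
    rw [hx, inner_smul_right, real_inner_comm, inner_gradient_left, mul_comm]
  rw [e1, e2, setIntegral_eq_integral_of_forall_compl_eq_zero,
    setIntegral_eq_integral_of_forall_compl_eq_zero]
  · have cφ := hφ.contDiff.continuous
    have cχ := hχ.contDiff.continuous
    have dφ : Continuous fun x => fderiv ℝ φ x e :=
      (hφ.contDiff.continuous_fderiv (by simp)).clm_apply continuous_const
    have dχ : Continuous fun x => fderiv ℝ χ x e :=
      (hχ.contDiff.continuous_fderiv (by simp)).clm_apply continuous_const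
    refine integral_mul_fderiv_eq_neg_fderiv_mul_of_integrable ?_ ?_ ?_
      (fun x _ => hχ.differentiable x) (fun x _ => hφ.differentiable x)
    · exact (dχ.mul cφ).integrable_of_hasCompactSupport hφ.hasCompactSupport.mul_left
    · exact (cχ.mul dφ).integrable_of_hasCompactSupport hχ.hasCompactSupport.mul_right
    · exact (cχ.mul cφ).integrable_of_hasCompactSupport hχ.hasCompactSupport.mul_right
  · intro x hx
    rw [image_eq_zero_of_notMem_tsupport (fun h => hx (hφ.tsupport_subset h)), mul_zero]
  · intro x hx
    rw [image_eq_zero_of_notMem_tsupport (fun h => hx (hχ.tsupport_subset h)), zero_mul]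

/-- The gradient component of an element of `H10 Ω` is determined by its function component. -/
theorem H10.gradient_unique {d : ℕ} {Ω : Set (Rd d)} (hΩ : IsOpen Ω) {p q : L2 Ω × L2Vec Ω}
    (hp : p ∈ H10 Ω) (hq : q ∈ H10 Ω) (h : p.1 = q.1) : p.2 = q.2 := by
  have hi : ∀ (G : L2Vec Ω) (φ : Rd d → ℝ), IsTestFunction Ω φ →
      Integrable (fun x => φ x • G x) (volume.restrict Ω) := fun G φ hφ =>
    memLp_one_iff_integrable.1 ((Lp.memLp G).smul (p := 2) (q := 2) (r := 1)
      (hφ.contDiff.continuous.memLp_of_hasCompactSupport hφ.hasCompactSupport))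
  have hloc : ∀ G : L2Vec Ω, LocallyIntegrableOn (fun x => G x) Ω volume := fun G =>
    locallyIntegrableOn_of_locallyIntegrable_restrict
      ((Lp.memLp G).locallyIntegrable (by norm_num))
  have key := hΩ.ae_eq_zero_of_integral_contDiff_smul_eq_zero
    ((hloc p.2).sub (hloc q.2)) (fun φ h1 h2 h3 => by
      have hφ : IsTestFunction Ω φ := ⟨h1, h2, h3⟩
      have a1 := H10.hasWeakGradient hp φ hφ
      have a2 := H10.hasWeakGradient hq φ hφ
      rw [h, a2] at a1
      rw [← setIntegral_eq_integral_of_forall_compl_eq_zero (s := Ω)]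
      · simp only [Pi.sub_apply, smul_sub]
        rw [integral_sub (hi _ φ hφ) (hi _ φ hφ), ← neg_inj.mp a1, sub_self]
      · intro x hx
        rw [image_eq_zero_of_notMem_tsupport (fun h => hx (h3 h)), zero_smul])
  refine Lp.ext ?_
  have hk := (ae_restrict_iff' hΩ.measurableSet).2 key
  filter_upwards [hk] with x hx
  exact sub_eq_zero.mp hx

/-! ## Gradient discretisations -/

/-- A gradient discretisation on the finite-dimensional space `X`: linear reconstructions of a
function and of a gradient, such that `v ↦ ‖∇_D v‖_{L²}` is a norm on `X` (since `∇_D` is linear,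
only definiteness has to be required), and a quadrature operator `L²(Ω) → L²(Ω)`. -/
structure GradientDiscretisation {d : ℕ} (Ω : Set (Rd d)) (X : Type*)
    [AddCommGroup X] [Module ℝ X] [FiniteDimensional ℝ X] where
  /-- function reconstruction `Π_D` -/
  recon : X →ₗ[ℝ] L2 Ω
  /-- gradient reconstruction `∇_D` -/
  grad : X →ₗ[ℝ] L2Vec Ω
  /-- `‖∇_D ·‖_{L²}` is definite -/
  eq_zero_of_norm_grad : ∀ v : X, ‖grad v‖ = 0 → v = 0
  /-- quadrature operator `Q_D`, an arbitrary map (neither linear nor bounded in general) -/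
  quad : L2 Ω → L2 Ω

namespace GradientDiscretisation

variable {d : ℕ} {Ω : Set (Rd d)} {X : Type*} [AddCommGroup X] [Module ℝ X]
  [FiniteDimensional ℝ X]

/-- `C_D = max_{v ≠ 0} ‖Π_D v‖ / ‖∇_D v‖` (it is `0` if `X = {0}`). -/
def coercivityConst (D : GradientDiscretisation Ω X) : ℝ :=
  ⨆ v : {v : X // v ≠ 0}, ‖D.recon v‖ / ‖D.grad v‖

/-- `S_D(φ) = min_v (‖∇_D v - ∇φ‖ + ‖Π_D v - φ‖)`, for `p = (φ, ∇φ)`. -/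
def interpError (D : GradientDiscretisation Ω X) (p : L2 Ω × L2Vec Ω) : ℝ :=
  ⨅ v : X, (‖D.grad v - p.2‖ + ‖D.recon v - p.1‖)

/-- `W_D(ψ) = max_{v ≠ 0} |∫_Ω (∇_D v · ψ + Π_D v div ψ)| / ‖∇_D v‖`, where `δ = div ψ`
(it is `0` if `X = {0}`). -/
def conformityDefect (D : GradientDiscretisation Ω X) (ψ : L2Vec Ω) (δ : L2 Ω) : ℝ :=
  ⨆ v : {v : X // v ≠ 0},
    1 / ‖D.grad v‖ * |∫ x in Ω, (inner ℝ (D.grad v x) (ψ x) + D.recon v x * δ x)|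

end GradientDiscretisation

/-- The space `{v = (v_i)_{i ∈ I} : v_i = 0 for all i ∈ B}`, `B` being the set of boundary
indices. -/
def nodalSpace {I : Type*} (B : Set I) : Submodule ℝ (I → ℝ) where
  carrier := {v | ∀ i ∈ B, v i = 0}
  zero_mem' := fun _ _ => rfl
  add_mem' := by
    intro v w hv hw i hi
    simp [hv i hi, hw i hi]
  smul_mem' := by
    intro c v hv i hi
    simp [hv i hi]

/-- `g(v) = (g(v_i))_{i ∈ I}` for `g : ℝ → ℝ` with `g 0 = 0`. -/
def nodalMap {I : Type*} {B : Set I} (g : ℝ → ℝ) (hg : g 0 = 0) (v : nodalSpace B) :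
    nodalSpace B :=
  ⟨fun i => g (v.1 i), fun i hi => by
    have h : v.1 i = 0 := v.2 i hi
    show g (v.1 i) = 0
    rw [h, hg]⟩

/-- `Π_D` is piecewise constant: for some partition `(U_i)_{i ∈ I}` of `Ω` (some `U_i` may be
empty), `Π_D v = ∑ i, v_i 1_{U_i}` for all `v`. Measurability of the `U_i` with `i ∉ B` up to null
sets follows from `Π_D v ∈ L²(Ω)`. -/
def IsPiecewiseConstant {d : ℕ} {Ω : Set (Rd d)} {I : Type*} [Fintype I] {B : Set I}
    (D : GradientDiscretisation Ω (nodalSpace B)) : Prop :=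
  ∃ U : I → Set (Rd d),
    Pairwise (Function.onFun Disjoint U) ∧ (⋃ i, U i) = Ω ∧
    ∀ v : nodalSpace B, ∀ᵐ x ∂(volume.restrict Ω),
      D.recon v x = ∑ i, (U i).indicator (fun _ => v.1 i) x

/-! ## The continuous problem and the gradient scheme -/

/-- `∫_Ω Λ G · H`. -/
def diffusionForm {d : ℕ} {Ω : Set (Rd d)} (Λ : Rd d → Matrix (Fin d) (Fin d) ℝ)
    (G H : L2Vec Ω) : ℝ :=
  ∫ x in Ω, dotProduct ((Λ x).mulVec (G x).ofLp) (H x).ofLp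

/-- `u ∈ L²(Ω)` is a weak solution of `β(u) - div(Λ∇ζ(u)) = f + div F` in `Ω`, `ζ(u) = 0` on `∂Ω`:
`ζ(u) ∈ H¹₀(Ω)` (the pair `z` is `(ζ(u), ∇ζ(u))`) and the equation holds when tested against every
`v ∈ H¹₀(Ω)` (the pair `v` is `(v, ∇v)`). -/
def IsWeakSolution {d : ℕ} (Ω : Set (Rd d)) (β ζ : ℝ → ℝ)
    (Λ : Rd d → Matrix (Fin d) (Fin d) ℝ) (f : L2 Ω) (F : L2Vec Ω) (u : L2 Ω) : Prop :=
  ∃ z ∈ H10 Ω, (∀ᵐ x ∂(volume.restrict Ω), z.1 x = ζ (u x)) ∧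
    ∀ v ∈ H10 Ω,
      (∫ x in Ω, β (u x) * v.1 x) + diffusionForm Λ z.2 v.2
        = (∫ x in Ω, f x * v.1 x) - ∫ x in Ω, inner ℝ (F x) (v.2 x)

/-- `u ∈ X_{D,0}` is a solution of the gradient scheme: for all `v ∈ X_{D,0}`,
`∫ β(Π_D u) Π_D v + ∫ Λ ∇_D ζ(u) · ∇_D v = ∫ Q_D f Π_D v - ∫ F · ∇_D v`. -/
def IsSchemeSolution {d : ℕ} {Ω : Set (Rd d)} {I : Type*} [Finite I] {B : Set I}
    (D : GradientDiscretisation Ω (nodalSpace B)) (β ζ : ℝ → ℝ) (hζ0 : ζ 0 = 0)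
    (Λ : Rd d → Matrix (Fin d) (Fin d) ℝ) (f : L2 Ω) (F : L2Vec Ω) (u : nodalSpace B) : Prop :=
  ∀ v : nodalSpace B,
    (∫ x in Ω, β (D.recon u x) * D.recon v x)
        + diffusionForm Λ (D.grad (nodalMap ζ hζ0 u)) (D.grad v)
      = (∫ x in Ω, D.quad f x * D.recon v x) - ∫ x in Ω, inner ℝ (F x) (D.grad v x)

end GradScheme

end

/-! The argument is compactness plus uniqueness, run along ultrafilters on `ℕ` instead of
subsequences. Testing the scheme with `ζ(u_m)` and using that `β` and `ζ` have the same sign gives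
the energy bound `IsSchemeSolution.norm_grad_le`. Coercivity then bounds `Π ζ(u_m)`, and the two
growth conditions bound `Π β(u_m)`. Along an ultrafilter, `Π ζ(u_m)` converges strongly by
compactness, while `∇ζ(u_m)` and `Π β(u_m)` converge weakly. By limit-conformity, the limit of `ζ`
and that of its gradient form an element of `H10 Ω` (`mem_H10_of_tendsto`).

The nonlinear limits are identified by a Minty argument (`exists_eq_of_tendsto`). Since `β + ζ` is a
homeomorphism of the line, a function `U` is defined by `β(U) + ζ(U) =` sum of the two limits;
monotonicity of `β` against `ζ` then forces each limit to be the matching function of `U`.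
Interpolants of `H10 Ω` functions pass the scheme to the limit, so `U` is a weak solution. Comparing
the energy identities of the scheme and of the limit gives `a(∇ζ(u_m), ∇ζ(u_m)) → a(∇ζ(U), ∇ζ(U))`,
which upgrades weak to strong convergence of the gradients by coercivity of `a`. These steps form
`exists_limit`.

Weak solutions are unique (`IsWeakSolution.unique`); the Poincaré-type fact this needs comes from
coercivity and consistency of the discretisations. Hence all ultrafilters finer than `atTop` give
the same limits, which is convergence of the whole sequence. -/

namespace GradScheme

/-! ## Weak convergence in Hilbert spaces -/

section Hilbert

variable {ι H K : Type*} [NormedAddCommGroup H] [InnerProductSpace ℝ H]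
  [NormedAddCommGroup K] [InnerProductSpace ℝ K]

/-- Bounded families converge weakly along ultrafilters. -/
lemma exists_weak_limit_of_bounded [CompleteSpace H] (l : Ultrafilter ι) {x : ι → H} {C : ℝ}
    (hx : ∀ i, ‖x i‖ ≤ C) :
    ∃ x₀ : H, ∀ y : H, Tendsto (fun i => inner ℝ (x i) y) l (𝓝 (inner ℝ x₀ y)) := by
  -- Banach–Alaoglu in the dual; the Riesz isometry carries the compactness back to `H`.
  have hc := WeakDual.isCompact_closedBall (𝕜 := ℝ) (0 : StrongDual ℝ H) C
  obtain ⟨T, -, hT⟩ := isCompact_iff_ultrafilter_le_nhds.1 hc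
    (l.map fun i => StrongDual.toWeakDual (InnerProductSpace.toDual ℝ H (x i))) (by
      rw [le_principal_iff, Ultrafilter.mem_coe, Ultrafilter.mem_map]
      refine Filter.mem_of_superset Filter.univ_mem fun i _ => ?_
      simpa using hx i)
  refine ⟨(InnerProductSpace.toDual ℝ H).symm (WeakDual.toStrongDual T), fun y => ?_⟩
  have hT' : Tendsto (fun i => StrongDual.toWeakDual (InnerProductSpace.toDual ℝ H (x i)))
    (l : Filter ι) (𝓝 T) := hT
  have h := ((WeakDual.eval_continuous (𝕜 := ℝ) y).tendsto T).comp hT'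
  rw [InnerProductSpace.toDual_symm_apply]
  exact h

/-- A bounded bilinear form converges on pairs made of a bounded weakly convergent family and of a
strongly convergent family. -/
lemma tendsto_bilin_of_weak_of_strong [CompleteSpace H] (a : H →L[ℝ] K →L[ℝ] ℝ) {l : Filter ι}
    {x : ι → H} {x₀ : H} {y : ι → K} {y₀ : K} {C : ℝ} (hb : ∀ i, ‖x i‖ ≤ C)
    (hx : ∀ z : H, Tendsto (fun i => inner ℝ (x i) z) l (𝓝 (inner ℝ x₀ z)))
    (hy : Tendsto y l (𝓝 y₀)) : Tendsto (fun i => a (x i) (y i)) l (𝓝 (a x₀ y₀)) := by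
  have h1 : Tendsto (fun i => a (x i) y₀) l (𝓝 (a x₀ y₀)) := by
    -- Weak convergence is tested against the Riesz representer of `a(·, y₀)`; the remainder `a(x i,
    -- y i - y₀)` is controlled by the bound on `x`.
    have h := hx ((InnerProductSpace.toDual ℝ H).symm (a.flip y₀))
    have e : ∀ w : H, inner ℝ w ((InnerProductSpace.toDual ℝ H).symm (a.flip y₀)) = a w y₀ :=
      fun w => by rw [real_inner_comm, InnerProductSpace.toDual_symm_apply]; rfl
    simpa only [e] using h
  have h2 : Tendsto (fun i => a (x i) (y i - y₀)) l (𝓝 0) := by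
    have h3 : Tendsto (fun i => ‖a‖ * C * ‖y i - y₀‖) l (𝓝 0) := by
      simpa using (tendsto_iff_norm_sub_tendsto_zero.1 hy).const_mul (‖a‖ * C)
    refine squeeze_zero_norm (fun i => (a.le_opNorm₂ _ _).trans ?_) h3
    gcongr
    exact hb i
  simpa using h1.add h2

lemma tendsto_inner_of_weak_of_strong [CompleteSpace H] {l : Filter ι}
    {x : ι → H} {x₀ : H} {y : ι → H} {y₀ : H} {C : ℝ} (hb : ∀ i, ‖x i‖ ≤ C)
    (hx : ∀ z : H, Tendsto (fun i => inner ℝ (x i) z) l (𝓝 (inner ℝ x₀ z)))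
    (hy : Tendsto y l (𝓝 y₀)) : Tendsto (fun i => inner ℝ (x i) (y i)) l (𝓝 (inner ℝ x₀ y₀)) :=
  tendsto_bilin_of_weak_of_strong (innerSL ℝ) hb hx hy

lemma tendsto_toWeakSpace_of_inner [CompleteSpace H] {l : Filter ι} {x : ι → H} {x₀ : H}
    (hx : ∀ z : H, Tendsto (fun i => inner ℝ (x i) z) l (𝓝 (inner ℝ x₀ z))) :
    Tendsto (fun i => toWeakSpace ℝ H (x i)) l (𝓝 (toWeakSpace ℝ H x₀)) := by
  have hn : 𝓝 (toWeakSpace ℝ H x₀) = comap (fun (x : WeakBilin (topDualPairing ℝ H).flip)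
      (T : StrongDual ℝ H) => (topDualPairing ℝ H).flip x T) _ := nhds_induced _ _
  rw [hn]
  refine tendsto_comap_iff.2 (tendsto_pi_nhds.2 fun T => ?_)
  have h := hx ((InnerProductSpace.toDual ℝ H).symm T)
  have e : ∀ w : H, inner ℝ w ((InnerProductSpace.toDual ℝ H).symm T) = T w :=
    fun w => by rw [real_inner_comm, InnerProductSpace.toDual_symm_apply]
  simp only [e] at h
  exact h

/-- A point on which all the functionals vanishing on a subspace vanish is in its closure. -/
lemma mem_topologicalClosure_of_forall_dual {E : Type*} [NormedAddCommGroup E] [NormedSpace ℝ E]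
    (S : Submodule ℝ E) (p : E) (h : ∀ T : E →L[ℝ] ℝ, (∀ q ∈ S, T q = 0) → T p = 0) :
    p ∈ S.topologicalClosure := by
  by_contra hp
  have : IsClosed (S.topologicalClosure : Set E) := S.isClosed_topologicalClosure
  -- Hahn–Banach in the quotient by the closure: a functional norming the nonzero class of `p` pulls
  -- back to one that vanishes on `S` but not at `p`.
  have hne : ‖S.topologicalClosure.mkQL p‖ ≠ 0 := by
    rw [norm_ne_zero_iff]
    intro h0
    exact hp ((Submodule.Quotient.mk_eq_zero _).1 h0)
  obtain ⟨g, -, hg⟩ := exists_dual_vector ℝ _ hne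
  have h1 := h (g.comp S.topologicalClosure.mkQL) fun q hq => by
    have : S.topologicalClosure.mkQL q = 0 :=
      (Submodule.Quotient.mk_eq_zero _).2 (S.le_topologicalClosure hq)
    rw [ContinuousLinearMap.comp_apply, this, map_zero]
  rw [ContinuousLinearMap.comp_apply, hg] at h1
  exact hne h1

end Hilbert

/-! ## The diffusion form -/

-- Subtracting a scalar matrix translates the spectrum, so `M - lam` and `Lam - M` are symmetric
-- with nonnegative spectrum, hence positive semidefinite.
open scoped MatrixOrder in
lemma dotProduct_mulVec_bounds {n : Type*} [Fintype n] [DecidableEq n] {M : Matrix n n ℝ}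
    {lam Lam : ℝ} (hM : M.IsSymm) (hs : spectrum ℝ M ⊆ Set.Icc lam Lam) (x : n → ℝ) :
    lam * (x ⬝ᵥ x) ≤ M.mulVec x ⬝ᵥ x ∧ M.mulVec x ⬝ᵥ x ≤ Lam * (x ⬝ᵥ x) := by
  have hH : M.IsHermitian := by
    rw [Matrix.IsHermitian, Matrix.conjTranspose_eq_transpose_of_trivial]
    exact hM
  have hS : ∀ c : ℝ, (algebraMap ℝ (Matrix n n ℝ) c).IsHermitian := fun c => by
    rw [Matrix.algebraMap_eq_diagonal]
    exact Matrix.isHermitian_diagonal _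
  constructor
  · have h1 : (M - algebraMap ℝ _ lam).PosSemidef := by
      refine Matrix.posSemidef_iff_isHermitian_and_spectrum_nonneg.2 ⟨hH.sub (hS _), ?_⟩
      rw [← spectrum.sub_singleton_eq]
      rintro _ ⟨y, hy, _, rfl, rfl⟩
      exact sub_nonneg.2 (hs hy).1
    have h2 := h1.dotProduct_mulVec_nonneg x
    rw [Matrix.sub_mulVec, Algebra.algebraMap_eq_smul_one, Matrix.smul_mulVec, Matrix.one_mulVec,
      star_trivial, dotProduct_sub, dotProduct_smul, smul_eq_mul, dotProduct_comm x] at h2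
    linarith
  · have h1 : (algebraMap ℝ _ Lam - M).PosSemidef := by
      refine Matrix.posSemidef_iff_isHermitian_and_spectrum_nonneg.2 ⟨(hS _).sub hH, ?_⟩
      rw [← spectrum.singleton_sub_eq]
      rintro _ ⟨_, rfl, y, hy, rfl⟩
      exact sub_nonneg.2 (hs hy).2
    have h2 := h1.dotProduct_mulVec_nonneg x
    rw [Matrix.sub_mulVec, Algebra.algebraMap_eq_smul_one, Matrix.smul_mulVec, Matrix.one_mulVec,
      star_trivial, dotProduct_sub, dotProduct_smul, smul_eq_mul, dotProduct_comm x (M.mulVec x)]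
      at h2
    linarith

/-- Polarisation: `4 Mx·y` is the difference of the quadratic form at `x + y` and at `x - y`, both
nonnegative and at most `Lam` times the squared norm. The bound by a sum of squares is integrable as
it stands. -/
lemma abs_dotProduct_mulVec_le {n : Type*} [Fintype n] [DecidableEq n] {M : Matrix n n ℝ}
    {lam Lam : ℝ} (hlam : 0 ≤ lam) (hM : M.IsSymm) (hs : spectrum ℝ M ⊆ Set.Icc lam Lam)
    (x y : n → ℝ) : |M.mulVec x ⬝ᵥ y| ≤ Lam / 2 * (x ⬝ᵥ x + y ⬝ᵥ y) := by
  have hp := dotProduct_mulVec_bounds hM hs (x + y)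
  have hm := dotProduct_mulVec_bounds hM hs (x - y)
  have hc : M.mulVec y ⬝ᵥ x = M.mulVec x ⬝ᵥ y := by
    rw [dotProduct_comm, Matrix.dotProduct_mulVec, ← Matrix.mulVec_transpose, hM.eq]
  have h0 : ∀ z : n → ℝ, 0 ≤ lam * (z ⬝ᵥ z) := fun z =>
    mul_nonneg hlam (Finset.sum_nonneg fun i _ => mul_self_nonneg (z i))
  have h1 := h0 (x + y)
  have h2 := h0 (x - y)
  simp only [Matrix.mulVec_add, Matrix.mulVec_sub, add_dotProduct, dotProduct_add,
    sub_dotProduct, dotProduct_sub, hc, dotProduct_comm y x] at hp hm h1 h2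
  rw [abs_le]
  constructor <;> linarith

lemma dotProduct_self_ofLp {d : ℕ} (x : Rd d) : x.ofLp ⬝ᵥ x.ofLp = ‖x‖ ^ 2 := by
  rw [EuclideanSpace.real_norm_sq_eq]
  simp [dotProduct, sq]

lemma norm_sq_eq_integral {d : ℕ} {Ω : Set (Rd d)} (G : L2Vec Ω) :
    ‖G‖ ^ 2 = ∫ x in Ω, ‖G x‖ ^ 2 := by
  rw [← real_inner_self_eq_norm_sq, L2.inner_def]
  simp only [real_inner_self_eq_norm_sq]

lemma integrable_norm_sq {d : ℕ} {Ω : Set (Rd d)} (G : L2Vec Ω) :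
    Integrable (fun x => ‖G x‖ ^ 2) (volume.restrict Ω) := by
  have h := L2.integrable_inner (𝕜 := ℝ) G G
  simpa only [real_inner_self_eq_norm_sq] using h

section Diffusion

variable {d : ℕ} {Ω : Set (Rd d)} {Λ : Rd d → Matrix (Fin d) (Fin d) ℝ} {lam Lam : ℝ}

lemma aestronglyMeasurable_diffusion
    (hΛ_meas : ∀ i j, AEMeasurable (fun x => Λ x i j) (volume.restrict Ω)) (G H : L2Vec Ω) :
    AEStronglyMeasurable (fun x => (Λ x).mulVec (G x).ofLp ⬝ᵥ (H x).ofLp)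
      (volume.restrict Ω) := by
  have hc : ∀ (G : L2Vec Ω) i, AEMeasurable (fun x => (G x).ofLp i) (volume.restrict Ω) :=
    fun G i => ((EuclideanSpace.proj (𝕜 := ℝ) i).continuous.comp_aestronglyMeasurable
      (Lp.aestronglyMeasurable G)).aemeasurable
  refine AEMeasurable.aestronglyMeasurable ?_
  simp only [dotProduct, Matrix.mulVec]
  refine Finset.aemeasurable_fun_sum _ fun i _ => AEMeasurable.mul ?_ (hc H i)
  exact Finset.aemeasurable_fun_sum _ fun j _ => (hΛ_meas i j).mul (hc G j)

lemma ae_abs_diffusion_le (hlam : 0 ≤ lam) (hΛ : ∀ᵐ x ∂(volume.restrict Ω),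
      (Λ x).IsSymm ∧ spectrum ℝ (Λ x) ⊆ Set.Icc lam Lam) (G H : L2Vec Ω) :
    ∀ᵐ x ∂(volume.restrict Ω), ‖(Λ x).mulVec (G x).ofLp ⬝ᵥ (H x).ofLp‖
      ≤ Lam / 2 * (‖G x‖ ^ 2 + ‖H x‖ ^ 2) := by
  filter_upwards [hΛ] with x hx
  rw [← dotProduct_self_ofLp, ← dotProduct_self_ofLp]
  exact abs_dotProduct_mulVec_le hlam hx.1 hx.2 _ _

lemma integrable_diffusion
    (hΛ_meas : ∀ i j, AEMeasurable (fun x => Λ x i j) (volume.restrict Ω)) (hlam : 0 ≤ lam)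
    (hΛ : ∀ᵐ x ∂(volume.restrict Ω), (Λ x).IsSymm ∧ spectrum ℝ (Λ x) ⊆ Set.Icc lam Lam)
    (G H : L2Vec Ω) :
    Integrable (fun x => (Λ x).mulVec (G x).ofLp ⬝ᵥ (H x).ofLp) (volume.restrict Ω) :=
  (((integrable_norm_sq G).add (integrable_norm_sq H)).const_mul (Lam / 2)).mono'
    (aestronglyMeasurable_diffusion hΛ_meas G H) (ae_abs_diffusion_le hlam hΛ G H)

lemma abs_diffusionForm_le_sq (hlam : 0 ≤ lam)
    (hΛ : ∀ᵐ x ∂(volume.restrict Ω), (Λ x).IsSymm ∧ spectrum ℝ (Λ x) ⊆ Set.Icc lam Lam)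
    (G H : L2Vec Ω) : |diffusionForm Λ G H| ≤ Lam / 2 * (‖G‖ ^ 2 + ‖H‖ ^ 2) := by
  rw [norm_sq_eq_integral, norm_sq_eq_integral,
    ← integral_add (integrable_norm_sq G) (integrable_norm_sq H), ← integral_const_mul]
  exact norm_integral_le_of_norm_le
    (((integrable_norm_sq G).add (integrable_norm_sq H)).const_mul (Lam / 2))
    (ae_abs_diffusion_le hlam hΛ G H)

lemma diffusionForm_smul_left (c : ℝ) (G H : L2Vec Ω) :
    diffusionForm Λ (c • G) H = c * diffusionForm Λ G H := by
  rw [diffusionForm, diffusionForm, ← integral_const_mul]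
  refine integral_congr_ae ?_
  filter_upwards [Lp.coeFn_smul c G] with x hx
  rw [hx, Pi.smul_apply, WithLp.ofLp_smul, Matrix.mulVec_smul, smul_dotProduct, smul_eq_mul]

lemma diffusionForm_smul_right (c : ℝ) (G H : L2Vec Ω) :
    diffusionForm Λ G (c • H) = c * diffusionForm Λ G H := by
  rw [diffusionForm, diffusionForm, ← integral_const_mul]
  refine integral_congr_ae ?_
  filter_upwards [Lp.coeFn_smul c H] with x hx
  rw [hx, Pi.smul_apply, WithLp.ofLp_smul, dotProduct_smul, smul_eq_mul]

/-- Homogeneity turns the bound by a sum of squares into one by a product: apply the former to the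
normalised fields, the zero cases being separate. -/
lemma abs_diffusionForm_le (hlam : 0 ≤ lam)
    (hΛ : ∀ᵐ x ∂(volume.restrict Ω), (Λ x).IsSymm ∧ spectrum ℝ (Λ x) ⊆ Set.Icc lam Lam)
    (G H : L2Vec Ω) : |diffusionForm Λ G H| ≤ Lam * ‖G‖ * ‖H‖ := by
  rcases eq_or_ne G 0 with rfl | hG
  · have h := diffusionForm_smul_left (Λ := Λ) 0 0 H
    rw [zero_smul, zero_mul] at h
    simp [h]
  rcases eq_or_ne H 0 with rfl | hH
  · have h := diffusionForm_smul_right (Λ := Λ) 0 G 0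
    rw [zero_smul, zero_mul] at h
    simp [h]
  have hG' := norm_pos_iff.2 hG
  have hH' := norm_pos_iff.2 hH
  have h := abs_diffusionForm_le_sq hlam hΛ (‖G‖⁻¹ • G) (‖H‖⁻¹ • H)
  rw [diffusionForm_smul_left, diffusionForm_smul_right, norm_smul, norm_smul, norm_inv, norm_inv,
    norm_norm, norm_norm, inv_mul_cancel₀ hG'.ne', inv_mul_cancel₀ hH'.ne', abs_mul, abs_mul,
    abs_of_pos (inv_pos.2 hG'), abs_of_pos (inv_pos.2 hH'), ← mul_assoc, ← mul_inv,
    inv_mul_le_iff₀ (by positivity)] at h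
  linarith

/-- The diffusion form is represented by a bounded coercive bilinear form. -/
lemma exists_diffusion_bilin
    (hΛ_meas : ∀ i j, AEMeasurable (fun x => Λ x i j) (volume.restrict Ω)) (hlam : 0 ≤ lam)
    (hΛ : ∀ᵐ x ∂(volume.restrict Ω), (Λ x).IsSymm ∧ spectrum ℝ (Λ x) ⊆ Set.Icc lam Lam) :
    ∃ a : L2Vec Ω →L[ℝ] L2Vec Ω →L[ℝ] ℝ, (∀ G H, diffusionForm Λ G H = a G H) ∧
      ∀ G, lam * ‖G‖ ^ 2 ≤ a G G := by
  have hi := integrable_diffusion hΛ_meas hlam hΛ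
  refine ⟨LinearMap.mkContinuous₂ (LinearMap.mk₂ ℝ (diffusionForm Λ) ?_ diffusionForm_smul_left ?_
    diffusionForm_smul_right) Lam (abs_diffusionForm_le hlam hΛ), fun G H => rfl, fun G => ?_⟩
  · intro G G' H
    rw [diffusionForm, diffusionForm, diffusionForm, ← integral_add (hi _ _) (hi _ _)]
    refine integral_congr_ae ?_
    filter_upwards [Lp.coeFn_add G G'] with x hx
    rw [hx, Pi.add_apply, WithLp.ofLp_add, Matrix.mulVec_add, add_dotProduct]
  · intro G H H'
    rw [diffusionForm, diffusionForm, diffusionForm, ← integral_add (hi _ _) (hi _ _)]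
    refine integral_congr_ae ?_
    filter_upwards [Lp.coeFn_add H H'] with x hx
    rw [hx, Pi.add_apply, WithLp.ofLp_add, dotProduct_add]
  · change lam * ‖G‖ ^ 2 ≤ diffusionForm Λ G G
    rw [norm_sq_eq_integral, ← integral_const_mul]
    refine integral_mono_ae ((integrable_norm_sq G).const_mul lam) (hi G G) ?_
    filter_upwards [hΛ] with x hx
    rw [← dotProduct_self_ofLp]
    exact (dotProduct_mulVec_bounds hx.1 hx.2 _).1

end Diffusion

/-! ## Functions in `L²(Ω)` -/

section L2

variable {d : ℕ} {Ω : Set (Rd d)}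

lemma integral_mul_eq_inner (f g : L2 Ω) : ∫ x in Ω, f x * g x = inner ℝ f g := by
  rw [L2.inner_def]
  refine integral_congr_ae (Eventually.of_forall fun x => ?_)
  simp [mul_comm]

lemma norm_le_of_ae_le_affine [IsFiniteMeasure (volume.restrict Ω)] {h k : L2 Ω} {A B : ℝ}
    (hA : 0 ≤ A) (hB : 0 ≤ B) (hk : ∀ᵐ x ∂(volume.restrict Ω), |h x| ≤ A * |k x| + B) :
    ‖h‖ ≤ A * ‖k‖ + B * ‖Lp.const 2 (volume.restrict Ω) (1 : ℝ)‖ := by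
  have h1 : ‖h‖ ≤ ‖A • |k| + B • Lp.const 2 (volume.restrict Ω) (1 : ℝ)‖ := by
    refine Lp.norm_le_norm_of_ae_le ?_
    filter_upwards [hk, Lp.coeFn_add (A • |k|) (B • Lp.const 2 (volume.restrict Ω) (1 : ℝ)),
      Lp.coeFn_smul A |k|, Lp.coeFn_smul B (Lp.const 2 (volume.restrict Ω) (1 : ℝ)),
      Lp.coeFn_abs k, Lp.coeFn_const (p := 2) (μ := volume.restrict Ω) (1 : ℝ)]
      with x a1 a2 a3 a4 a5 a6
    rw [a2, Pi.add_apply, a3, a4, Pi.smul_apply, Pi.smul_apply, a5, a6]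
    simpa using a1.trans (le_abs_self _)
  refine h1.trans ((norm_add_le _ _).trans_eq ?_)
  rw [norm_smul, norm_smul, norm_abs_eq_norm, Real.norm_of_nonneg hA, Real.norm_of_nonneg hB]

lemma IsTestFunction.exists_mem_testPairs {φ : Rd d → ℝ} (hφ : IsTestFunction Ω φ) :
    ∃ p ∈ testPairs Ω, (∀ᵐ x ∂(volume.restrict Ω), p.1 x = φ x) ∧
      ∀ᵐ x ∂(volume.restrict Ω), p.2 x = ∇ φ x := by
  have h1 : MemLp φ 2 (volume.restrict Ω) :=
    hφ.contDiff.continuous.memLp_of_hasCompactSupport hφ.hasCompactSupport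
  have h2 : MemLp (fun x => ∇ φ x) 2 (volume.restrict Ω) :=
    hφ.continuous_gradient.memLp_of_hasCompactSupport hφ.hasCompactSupport_gradient
  exact ⟨(h1.toLp _, h2.toLp _), ⟨φ, hφ, h1.coeFn_toLp, h2.coeFn_toLp⟩, h1.coeFn_toLp,
    h2.coeFn_toLp⟩

/-- `H¹₀(Ω)` is dense in `L²(Ω)`. -/
lemma eq_zero_of_forall_inner_H10 (hΩ : IsOpen Ω) {b : L2 Ω}
    (hb : ∀ p ∈ H10 Ω, inner ℝ b p.1 = 0) : b = 0 := by
  have hloc : LocallyIntegrableOn (fun x => b x) Ω volume :=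
    locallyIntegrableOn_of_locallyIntegrable_restrict
      ((Lp.memLp b).locallyIntegrable (by norm_num))
  have key := hΩ.ae_eq_zero_of_integral_contDiff_smul_eq_zero hloc (fun φ h1 h2 h3 => by
    obtain ⟨p, hp, hp1, -⟩ := IsTestFunction.exists_mem_testPairs ⟨h1, h2, h3⟩
    rw [← setIntegral_eq_integral_of_forall_compl_eq_zero (s := Ω),
      ← hb p ((testPairs Ω).le_topologicalClosure hp), ← integral_mul_eq_inner]
    · refine integral_congr_ae ?_
      filter_upwards [hp1] with x hx
      rw [hx, smul_eq_mul, mul_comm]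
    · intro x hx
      rw [image_eq_zero_of_notMem_tsupport (fun h => hx (h3 h)), zero_smul])
  refine Lp.ext ?_
  filter_upwards [(ae_restrict_iff' hΩ.measurableSet).2 key, Lp.coeFn_zero ℝ 2 (volume.restrict Ω)]
    with x hx h0
  rw [hx, h0, Pi.zero_apply]

/-- `H¹₀(Ω)` is characterised by duality with `H_div(Ω)`. -/
lemma mem_H10_of_forall_hasWeakDivergence {p : L2 Ω × L2Vec Ω}
    (h : ∀ (ψ : L2Vec Ω) (δ : L2 Ω), HasWeakDivergence ψ δ →
      inner ℝ p.2 ψ + inner ℝ p.1 δ = 0) : p ∈ H10 Ω := by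
  refine mem_topologicalClosure_of_forall_dual _ _ fun T hT => ?_
  -- A functional on the product is a pair `(δ, ψ)` by Riesz; its vanishing on the pairs `(φ, ∇φ)`
  -- says precisely that `δ` is the weak divergence of `ψ`.
  set δ : L2 Ω := (InnerProductSpace.toDual ℝ (L2 Ω)).symm
    (T.comp (ContinuousLinearMap.inl ℝ (L2 Ω) (L2Vec Ω)))
  set ψ : L2Vec Ω := (InnerProductSpace.toDual ℝ (L2Vec Ω)).symm
    (T.comp (ContinuousLinearMap.inr ℝ (L2 Ω) (L2Vec Ω)))
  have hδ : ∀ q : L2 Ω × L2Vec Ω, T q = inner ℝ δ q.1 + inner ℝ ψ q.2 := fun q => by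
    rw [InnerProductSpace.toDual_symm_apply, InnerProductSpace.toDual_symm_apply,
      ContinuousLinearMap.comp_apply, ContinuousLinearMap.comp_apply, ← map_add]
    simp
  have hw : HasWeakDivergence ψ δ := fun φ hφ => by
    obtain ⟨q, hq, hq1, hq2⟩ := hφ.exists_mem_testPairs
    have h0 := hT q hq
    rw [hδ, ← integral_mul_eq_inner, L2.inner_def] at h0
    have e1 : ∫ x in Ω, inner ℝ (ψ x) (∇ φ x) = ∫ x in Ω, inner ℝ (ψ x) (q.2 x) := by
      refine integral_congr_ae ?_
      filter_upwards [hq2] with x hx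
      rw [hx]
    have e2 : ∫ x in Ω, δ x * φ x = ∫ x in Ω, δ x * q.1 x := by
      refine integral_congr_ae ?_
      filter_upwards [hq1] with x hx
      rw [hx]
    rw [e1, e2]
    linarith
  rw [hδ, real_inner_comm, real_inner_comm p.2, add_comm]
  exact h ψ δ hw

end L2

/-! ## Properties of gradient discretisations -/

namespace GradientDiscretisation

section Basic

variable {d : ℕ} {Ω : Set (Rd d)} {X : Type*} [AddCommGroup X] [Module ℝ X]
  [FiniteDimensional ℝ X]

lemma norm_grad_pos (D : GradientDiscretisation Ω X) {v : X} (hv : v ≠ 0) : 0 < ‖D.grad v‖ :=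
  (norm_nonneg _).lt_of_ne fun h => hv (D.eq_zero_of_norm_grad v h.symm)

/-- `∇_D` is injective, so `Π_D ∘ ∇_D⁻¹` is a linear map on a finite-dimensional space, hence
bounded. This makes the suprema defining `C_D` and `W_D` genuine: a real `⨆` over an unbounded
family would be the junk value `0`. -/
lemma exists_norm_recon_le (D : GradientDiscretisation Ω X) :
    ∃ C : ℝ, ∀ v, ‖D.recon v‖ ≤ C * ‖D.grad v‖ := by
  have hinj : Function.Injective D.grad := (injective_iff_map_eq_zero D.grad).2 fun v hv =>
    D.eq_zero_of_norm_grad v (by rw [hv, norm_zero])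
  set T := LinearMap.toContinuousLinearMap
    (D.recon ∘ₗ (LinearEquiv.ofInjective D.grad hinj).symm.toLinearMap)
  refine ⟨‖T‖, fun v => ?_⟩
  have h := T.le_opNorm (LinearEquiv.ofInjective D.grad hinj v)
  simpa [T] using h

lemma norm_recon_le (D : GradientDiscretisation Ω X) (v : X) :
    ‖D.recon v‖ ≤ D.coercivityConst * ‖D.grad v‖ := by
  rcases eq_or_ne v 0 with rfl | hv
  · simp
  obtain ⟨C, hC⟩ := D.exists_norm_recon_le
  rw [← div_le_iff₀ (D.norm_grad_pos hv)]
  refine le_ciSup (f := fun v : {v : X // v ≠ 0} => ‖D.recon v‖ / ‖D.grad v‖) ⟨C, ?_⟩ ⟨v, hv⟩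
  rintro _ ⟨w, rfl⟩
  exact (div_le_iff₀ (D.norm_grad_pos w.2)).2 (hC w)

lemma coercivityConst_nonneg (D : GradientDiscretisation Ω X) : 0 ≤ D.coercivityConst :=
  Real.iSup_nonneg fun _ => by positivity

lemma integral_conformity (D : GradientDiscretisation Ω X) (ψ : L2Vec Ω) (δ : L2 Ω) (v : X) :
    ∫ x in Ω, (inner ℝ (D.grad v x) (ψ x) + D.recon v x * δ x)
      = inner ℝ (D.grad v) ψ + inner ℝ (D.recon v) δ := by
  have h : Integrable (fun x => D.recon v x * δ x) (volume.restrict Ω) := by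
    simpa using L2.integrable_inner (𝕜 := ℝ) δ (D.recon v)
  rw [integral_add (L2.integrable_inner _ _) h, integral_mul_eq_inner, ← L2.inner_def]

lemma abs_conformity_le (D : GradientDiscretisation Ω X) (ψ : L2Vec Ω) (δ : L2 Ω) (v : X) :
    |inner ℝ (D.grad v) ψ + inner ℝ (D.recon v) δ| ≤ D.conformityDefect ψ δ * ‖D.grad v‖ := by
  rcases eq_or_ne v 0 with rfl | hv
  · simp
  obtain ⟨C, hC⟩ := D.exists_norm_recon_le
  rw [← div_le_iff₀ (D.norm_grad_pos hv)]
  refine le_ciSup_of_le (f := fun v : {v : X // v ≠ 0} => 1 / ‖D.grad v‖ *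
    |∫ x in Ω, (inner ℝ (D.grad v x) (ψ x) + D.recon v x * δ x)|) ⟨‖ψ‖ + C * ‖δ‖, ?_⟩ ⟨v, hv⟩ ?_
  · rintro _ ⟨w, rfl⟩
    dsimp only
    rw [integral_conformity, one_div, inv_mul_le_iff₀ (D.norm_grad_pos w.2)]
    calc _ ≤ ‖D.grad w‖ * ‖ψ‖ + ‖D.recon w‖ * ‖δ‖ :=
          (abs_add_le _ _).trans (add_le_add (abs_real_inner_le_norm _ _)
            (abs_real_inner_le_norm _ _))
      _ ≤ ‖D.grad w‖ * ‖ψ‖ + C * ‖D.grad w‖ * ‖δ‖ := by gcongr; exact hC w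
      _ = _ := by ring
  · rw [integral_conformity, one_div, div_eq_inv_mul]

lemma exists_interp_le (D : GradientDiscretisation Ω X) (p : L2 Ω × L2Vec Ω) {ε : ℝ}
    (hε : 0 < ε) : ∃ v, ‖D.grad v - p.2‖ + ‖D.recon v - p.1‖ < D.interpError p + ε :=
  exists_lt_of_ciInf_lt (lt_add_of_pos_right _ hε)

end Basic

/-! ### Consequences of consistency, coercivity and limit-conformity along a sequence. -/

section Sequence

variable {d : ℕ} {Ω : Set (Rd d)} {X : ℕ → Type*} [∀ m, AddCommGroup (X m)]
  [∀ m, Module ℝ (X m)] [∀ m, FiniteDimensional ℝ (X m)]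
  {D : ∀ m, GradientDiscretisation Ω (X m)}

lemma exists_interp_tendsto {p : L2 Ω × L2Vec Ω}
    (h : Tendsto (fun m => (D m).interpError p) atTop (𝓝 0)) :
    ∃ v : ∀ m, X m, Tendsto (fun m => (D m).recon (v m)) atTop (𝓝 p.1) ∧
      Tendsto (fun m => (D m).grad (v m)) atTop (𝓝 p.2) := by
  -- Near-minimisers with tolerance `1 / (m + 1)` suffice; no attained minimum is needed.
  choose v hv using fun m : ℕ => (D m).exists_interp_le p (Nat.one_div_pos_of_nat (α := ℝ) (n := m))
  have h0 := h.add (tendsto_one_div_add_atTop_nhds_zero_nat (𝕜 := ℝ))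
  rw [add_zero] at h0
  refine ⟨v, tendsto_iff_norm_sub_tendsto_zero.2 (squeeze_zero (fun _ => norm_nonneg _)
    (fun m => ?_) h0), tendsto_iff_norm_sub_tendsto_zero.2 (squeeze_zero (fun _ => norm_nonneg _)
    (fun m => ?_) h0)⟩
  · exact (le_add_of_nonneg_left (norm_nonneg _)).trans (hv m).le
  · exact (le_add_of_nonneg_right (norm_nonneg _)).trans (hv m).le

/-- A coercive and consistent sequence of discretisations yields: the elements of `H¹₀(Ω)` with
zero gradient vanish. -/
lemma eq_zero_of_gradient_eq_zero {C : ℝ} (hcoer : ∀ m, (D m).coercivityConst ≤ C)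
    {p : L2 Ω × L2Vec Ω} (h : Tendsto (fun m => (D m).interpError p) atTop (𝓝 0))
    (hp : p.2 = 0) : p.1 = 0 := by
  obtain ⟨v, hv1, hv2⟩ := exists_interp_tendsto h
  rw [hp] at hv2
  have h1 : Tendsto (fun m => C * ‖(D m).grad (v m)‖) atTop (𝓝 0) := by
    simpa using hv2.norm.const_mul C
  refine tendsto_nhds_unique hv1 (squeeze_zero_norm (fun m => ?_) h1)
  exact ((D m).norm_recon_le _).trans (by gcongr; exact hcoer m)

/-- Limits of the reconstructions of a bounded sequence belong to `H¹₀(Ω)`. -/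
lemma mem_H10_of_tendsto (hconf : ∀ (ψ : L2Vec Ω) (δ : L2 Ω), HasWeakDivergence ψ δ →
      Tendsto (fun m => (D m).conformityDefect ψ δ) atTop (𝓝 0)) {l : Filter ℕ} [l.NeBot]
    (hl : l ≤ atTop) {v : ∀ m, X m} {C : ℝ} (hv : ∀ m, ‖(D m).grad (v m)‖ ≤ C)
    {p : L2 Ω × L2Vec Ω} (h1 : Tendsto (fun m => (D m).recon (v m)) l (𝓝 p.1))
    (h2 : ∀ ψ, Tendsto (fun m => inner ℝ ((D m).grad (v m)) ψ) l (𝓝 (inner ℝ p.2 ψ))) :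
    p ∈ H10 Ω := by
  refine mem_H10_of_forall_hasWeakDivergence fun ψ δ hψ => ?_
  have h3 := (h2 ψ).add (h1.inner (tendsto_const_nhds (x := δ)))
  -- The pairing is at most `W_D(ψ)` times the gradient bound, so its limit is zero, which is the
  -- duality criterion for `H10 Ω`.
  have h4 : Tendsto (fun m => |(D m).conformityDefect ψ δ| * C) l (𝓝 0) := by
    simpa using ((hconf ψ δ hψ).mono_left hl).abs.mul_const C
  refine tendsto_nhds_unique h3 (squeeze_zero_norm (fun m => ?_) h4)
  refine ((D m).abs_conformity_le ψ δ (v m)).trans ?_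
  gcongr
  · exact le_abs_self _
  · exact hv m

end Sequence

end GradientDiscretisation

/-- Each point of `Ω` lies in exactly one cell, so the sum reduces to a single nodal value. This is
what lets `Π_D` commute with `ζ` and `β`. -/
lemma IsPiecewiseConstant.recon_nodalMap_ae {d : ℕ} {Ω : Set (Rd d)} (hΩ : MeasurableSet Ω)
    {I : Type*} [Fintype I] {B : Set I} {D : GradientDiscretisation Ω (nodalSpace B)}
    (hD : IsPiecewiseConstant D) {g : ℝ → ℝ} (hg : g 0 = 0) (v : nodalSpace B) :
    ∀ᵐ x ∂(volume.restrict Ω), D.recon (nodalMap g hg v) x = g (D.recon v x) := by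
  obtain ⟨U, hU, hUΩ, hr⟩ := hD
  filter_upwards [hr v, hr (nodalMap g hg v), ae_restrict_mem hΩ] with x h1 h2 hx
  rw [← hUΩ, Set.mem_iUnion] at hx
  obtain ⟨i, hi⟩ := hx
  have key : ∀ w : nodalSpace B, ∑ j, (U j).indicator (fun _ => w.1 j) x = w.1 i := fun w => by
    rw [Finset.sum_eq_single i, Set.indicator_of_mem hi]
    · intro j _ hj
      exact Set.indicator_of_notMem (fun h => Set.disjoint_left.1 (hU hj) h hi) _
    · simp
  rw [h1, h2, key, key]
  rfl

/-! ## The nonlinearities -/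

section Nonlinearities

variable {ζ β : ℝ → ℝ}

lemma mul_nonneg_of_monotone (hζ : Monotone ζ) (hβ : Monotone β) (s t : ℝ) :
    0 ≤ (ζ s - ζ t) * (β s - β t) := by
  rcases le_total s t with h | h
  · exact mul_nonneg_of_nonpos_of_nonpos (sub_nonpos.2 (hζ h)) (sub_nonpos.2 (hβ h))
  · exact mul_nonneg (sub_nonneg.2 (hζ h)) (sub_nonneg.2 (hβ h))

/-- `β s` and `ζ s` both have the sign of `s`. Consequently a bound on the sum `β + ζ` bounds each
term. -/
lemma abs_add_eq_of_monotone (hζ : Monotone ζ) (hβ : Monotone β) (hζ0 : ζ 0 = 0) (hβ0 : β 0 = 0)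
    (s : ℝ) : |β s + ζ s| = |β s| + |ζ s| := by
  rw [abs_add_eq_add_abs_iff]
  rcases le_total 0 s with h | h
  · exact Or.inl ⟨hβ0 ▸ hβ h, hζ0 ▸ hζ h⟩
  · exact Or.inr ⟨hβ0 ▸ hβ h, hζ0 ▸ hζ h⟩

lemma surjective_add (hζ_cont : Continuous ζ) (hβ_cont : Continuous β) (hζ : Monotone ζ)
    (hβ : Monotone β) (hζ0 : ζ 0 = 0) (hβ0 : β 0 = 0) {M₀ M₁ : ℝ} (hM₀ : 0 < M₀)
    (hgrowth : ∀ s : ℝ, M₀ * |s| - M₁ ≤ |ζ s|) : Function.Surjective (fun s => β s + ζ s) := by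
  have htop : Tendsto (fun s : ℝ => M₀ * s - M₁) atTop atTop :=
    tendsto_atTop_add_const_right _ _ (tendsto_id.const_mul_atTop hM₀)
  refine (hβ_cont.add hζ_cont).surjective ?_ ?_
  · refine tendsto_atTop_mono' _ ?_ htop
    filter_upwards [eventually_ge_atTop 0] with s hs
    have h1 : 0 ≤ β s := hβ0 ▸ hβ hs
    have h2 : 0 ≤ ζ s := hζ0 ▸ hζ hs
    have h3 := hgrowth s
    rw [abs_of_nonneg hs, abs_of_nonneg h2] at h3
    rw [Pi.add_apply]
    linarith
  · refine tendsto_atBot_mono' _ ?_ (tendsto_neg_atTop_atBot.comp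
      (htop.comp tendsto_neg_atBot_atTop))
    filter_upwards [eventually_le_atBot 0] with s hs
    have h1 : β s ≤ 0 := hβ0 ▸ hβ hs
    have h2 : ζ s ≤ 0 := hζ0 ▸ hζ hs
    have h3 := hgrowth s
    rw [abs_of_nonpos hs, abs_of_nonpos h2] at h3
    rw [Function.comp_apply, Function.comp_apply, Pi.add_apply]
    linarith

/-- Every `w ∈ L²(Ω)` can be written as `β(U) + ζ(U)` with `U`, `β(U)`, `ζ(U)` in `L²(Ω)`. -/
lemma exists_decomposition {d : ℕ} {Ω : Set (Rd d)} [IsFiniteMeasure (volume.restrict Ω)]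
    (hζ_cont : Continuous ζ) (hβ_cont : Continuous β) (hζ : Monotone ζ)
    (hβ : Monotone β) (hζ0 : ζ 0 = 0) (hβ0 : β 0 = 0) {M₀ M₁ : ℝ} (hM₀ : 0 < M₀)
    (hgrowth : ∀ s : ℝ, M₀ * |s| - M₁ ≤ |ζ s|) (hβζ : StrictMono (fun s => β s + ζ s))
    (w : L2 Ω) :
    ∃ U z b : L2 Ω, (∀ᵐ x ∂(volume.restrict Ω), z x = ζ (U x)) ∧
      (∀ᵐ x ∂(volume.restrict Ω), b x = β (U x)) ∧ z + b = w := by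
  set e := hβζ.orderIsoOfSurjective _
    (surjective_add hζ_cont hβ_cont hζ hβ hζ0 hβ0 hM₀ hgrowth)
  have he : ∀ y, β (e.symm y) + ζ (e.symm y) = y := fun y => e.apply_symm_apply y
  have hm : AEStronglyMeasurable (fun x => e.symm (w x)) (volume.restrict Ω) :=
    e.symm.continuous.comp_aestronglyMeasurable (Lp.aestronglyMeasurable w)
  have hsum : ∀ y, |y| = |β (e.symm y)| + |ζ (e.symm y)| := fun y => by
    rw [← abs_add_eq_of_monotone hζ hβ hζ0 hβ0, he]
  have hU : MemLp (fun x => e.symm (w x)) 2 (volume.restrict Ω) := by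
    refine MemLp.mono (g := fun x => M₀⁻¹ * (|w x| + M₁))
      (((Lp.memLp w).abs.add (memLp_const M₁)).const_mul _) hm (Eventually.of_forall fun x => ?_)
    refine le_trans ?_ (le_abs_self _)
    rw [Real.norm_eq_abs, ← div_eq_inv_mul, le_div_iff₀ hM₀, mul_comm]
    have h1 := hgrowth (e.symm (w x))
    have h2 := hsum (w x)
    have h3 := abs_nonneg (β (e.symm (w x)))
    linarith
  have hz : MemLp (fun x => ζ (e.symm (w x))) 2 (volume.restrict Ω) := by
    refine (Lp.memLp w).mono (hζ_cont.comp_aestronglyMeasurable hm)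
      (Eventually.of_forall fun x => ?_)
    rw [Real.norm_eq_abs, Real.norm_eq_abs, hsum (w x)]
    exact le_add_of_nonneg_left (abs_nonneg _)
  have hb : MemLp (fun x => β (e.symm (w x))) 2 (volume.restrict Ω) := by
    refine (Lp.memLp w).mono (hβ_cont.comp_aestronglyMeasurable hm)
      (Eventually.of_forall fun x => ?_)
    rw [Real.norm_eq_abs, Real.norm_eq_abs, hsum (w x)]
    exact le_add_of_nonneg_right (abs_nonneg _)
  refine ⟨hU.toLp _, hz.toLp _, hb.toLp _, ?_, ?_, Lp.ext ?_⟩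
  · filter_upwards [hU.coeFn_toLp, hz.coeFn_toLp] with x h1 h2
    rw [h1, h2]
  · filter_upwards [hU.coeFn_toLp, hb.coeFn_toLp] with x h1 h2
    rw [h1, h2]
  · filter_upwards [Lp.coeFn_add (hz.toLp _) (hb.toLp _), hz.coeFn_toLp, hb.coeFn_toLp]
      with x h1 h2 h3
    rw [h1, Pi.add_apply, h2, h3, add_comm, he]

lemma inner_nonneg_of_monotone {d : ℕ} {Ω : Set (Rd d)} (hζ : Monotone ζ) (hβ : Monotone β)
    {u w z z' b b' : L2 Ω} (hz : ∀ᵐ x ∂(volume.restrict Ω), z x = ζ (u x))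
    (hz' : ∀ᵐ x ∂(volume.restrict Ω), z' x = ζ (w x))
    (hb : ∀ᵐ x ∂(volume.restrict Ω), b x = β (u x))
    (hb' : ∀ᵐ x ∂(volume.restrict Ω), b' x = β (w x)) :
    0 ≤ inner ℝ (b - b') (z - z') := by
  rw [← integral_mul_eq_inner]
  refine integral_nonneg_of_ae ?_
  filter_upwards [hz, hz', hb, hb', Lp.coeFn_sub b b', Lp.coeFn_sub z z'] with x h1 h2 h3 h4 h5 h6
  rw [h5, h6, Pi.sub_apply, Pi.sub_apply, h1, h2, h3, h4]
  exact mul_nonneg_of_monotone hβ hζ _ _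

/-- A Minty-type argument identifying the limits of `ζ(uᵢ)` and `β(uᵢ)`. -/
lemma exists_eq_of_tendsto {d : ℕ} {Ω : Set (Rd d)} [IsFiniteMeasure (volume.restrict Ω)]
    (hζ_cont : Continuous ζ) (hβ_cont : Continuous β) (hζ : Monotone ζ)
    (hβ : Monotone β) (hζ0 : ζ 0 = 0) (hβ0 : β 0 = 0) {M₀ M₁ : ℝ} (hM₀ : 0 < M₀)
    (hgrowth : ∀ s : ℝ, M₀ * |s| - M₁ ≤ |ζ s|) (hβζ : StrictMono (fun s => β s + ζ s))
    {ι : Type*} {l : Filter ι} [l.NeBot] {u z b : ι → L2 Ω}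
    (hz : ∀ i, ∀ᵐ x ∂(volume.restrict Ω), z i x = ζ (u i x))
    (hb : ∀ i, ∀ᵐ x ∂(volume.restrict Ω), b i x = β (u i x))
    {C : ℝ} (hbC : ∀ i, ‖b i‖ ≤ C) {z₀ b₀ : L2 Ω} (hz₀ : Tendsto z l (𝓝 z₀))
    (hb₀ : ∀ y, Tendsto (fun i => inner ℝ (b i) y) l (𝓝 (inner ℝ b₀ y))) :
    ∃ U : L2 Ω, (∀ᵐ x ∂(volume.restrict Ω), z₀ x = ζ (U x)) ∧
      ∀ᵐ x ∂(volume.restrict Ω), b₀ x = β (U x) := by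
  obtain ⟨U, zU, bU, hzU, hbU, hsum⟩ := exists_decomposition hζ_cont hβ_cont hζ hβ hζ0 hβ0 hM₀
    hgrowth hβζ (z₀ + b₀)
  have h1 : Tendsto (fun i => inner ℝ (b i) (z i - zU) - inner ℝ bU (z i - zU)
      + inner ℝ (z i - zU) (z i - zU)) l (𝓝 (inner ℝ b₀ (z₀ - zU) - inner ℝ bU (z₀ - zU)
      + inner ℝ (z₀ - zU) (z₀ - zU))) := by
    have hs : Tendsto (fun i => z i - zU) l (𝓝 (z₀ - zU)) := hz₀.sub_const zU
    exact ((tendsto_inner_of_weak_of_strong hbC hb₀ hs).sub (tendsto_const_nhds.inner hs)).add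
      (hs.inner hs)
  have h2 : inner ℝ b₀ (z₀ - zU) - inner ℝ bU (z₀ - zU) + inner ℝ (z₀ - zU) (z₀ - zU) = 0 := by
    have h3 : b₀ - bU + (z₀ - zU) = 0 := by
      rw [sub_add_sub_comm, add_comm b₀, add_comm bU, hsum, sub_self]
    rw [← inner_sub_left, ← inner_add_left, h3, inner_zero_left]
  have hlim : Tendsto z l (𝓝 zU) := by
    rw [tendsto_iff_norm_sub_tendsto_zero]
    have h4 : Tendsto (fun i => ‖z i - zU‖ ^ 2) l (𝓝 0) := by
      rw [h2] at h1
      refine squeeze_zero (fun i => sq_nonneg _) (fun i => ?_) h1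
      rw [← inner_sub_left, real_inner_self_eq_norm_sq]
      exact le_add_of_nonneg_left (inner_nonneg_of_monotone hζ hβ (hz i) hzU (hb i) hbU)
    simpa using h4.sqrt
  have hzz : z₀ = zU := tendsto_nhds_unique hz₀ hlim
  have hbb : b₀ = bU := by
    rw [hzz] at hsum
    exact (add_left_cancel hsum).symm
  exact ⟨U, hzz ▸ hzU, hbb ▸ hbU⟩

end Nonlinearities

/-! ## Weak solutions -/

section WeakSolution

variable {d : ℕ} {Ω : Set (Rd d)} {β ζ : ℝ → ℝ} {Λ : Rd d → Matrix (Fin d) (Fin d) ℝ}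
  {f : L2 Ω} {F : L2Vec Ω} {a : L2Vec Ω →L[ℝ] L2Vec Ω →L[ℝ] ℝ}

lemma integral_comp_mul_eq_inner {g : ℝ → ℝ} {u b v : L2 Ω}
    (hb : ∀ᵐ x ∂(volume.restrict Ω), b x = g (u x)) :
    ∫ x in Ω, g (u x) * v x = inner ℝ b v := by
  rw [← integral_mul_eq_inner]
  refine integral_congr_ae ?_
  filter_upwards [hb] with x hx
  rw [hx]

lemma exists_L2_comp [IsFiniteMeasure (volume.restrict Ω)] (hβ_cont : Continuous β) {K₀ K₁ : ℝ}
    (hgrowth : ∀ s : ℝ, |β s| ≤ K₀ * |s| + K₁) (u : L2 Ω) :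
    ∃ b : L2 Ω, ∀ᵐ x ∂(volume.restrict Ω), b x = β (u x) := by
  have h : MemLp (fun x => β (u x)) 2 (volume.restrict Ω) := by
    refine MemLp.mono (g := fun x => K₀ * |u x| + K₁)
      (((Lp.memLp u).abs.const_mul _).add (memLp_const K₁))
      (hβ_cont.comp_aestronglyMeasurable (Lp.aestronglyMeasurable u))
      (Eventually.of_forall fun x => (hgrowth _).trans (le_abs_self _))
  exact ⟨h.toLp _, h.coeFn_toLp⟩

lemma isWeakSolution_of_inner (ha : ∀ G H, diffusionForm Λ G H = a G H) {u b : L2 Ω}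
    {z : L2 Ω × L2Vec Ω} (hz : z ∈ H10 Ω) (hzu : ∀ᵐ x ∂(volume.restrict Ω), z.1 x = ζ (u x))
    (hb : ∀ᵐ x ∂(volume.restrict Ω), b x = β (u x))
    (h : ∀ v ∈ H10 Ω, inner ℝ b v.1 + a z.2 v.2 = inner ℝ f v.1 - inner ℝ F v.2) :
    IsWeakSolution Ω β ζ Λ f F u := by
  refine ⟨z, hz, hzu, fun v hv => ?_⟩
  rw [integral_comp_mul_eq_inner hb, ha, integral_mul_eq_inner, ← L2.inner_def]
  exact h v hv

lemma IsWeakSolution.unique [IsFiniteMeasure (volume.restrict Ω)] (hΩ : IsOpen Ω)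
    (hβ_cont : Continuous β) (hζ : Monotone ζ) (hβ : Monotone β) {K₀ K₁ : ℝ}
    (hgrowth : ∀ s : ℝ, |β s| ≤ K₀ * |s| + K₁) (hβζ : StrictMono (fun s => β s + ζ s))
    (ha : ∀ G H, diffusionForm Λ G H = a G H) {lam : ℝ} (hlam : 0 < lam)
    (hcoer : ∀ G, lam * ‖G‖ ^ 2 ≤ a G G)
    (hpoincare : ∀ p ∈ H10 Ω, p.2 = 0 → p.1 = 0) {u w : L2 Ω}
    (hu : IsWeakSolution Ω β ζ Λ f F u) (hw : IsWeakSolution Ω β ζ Λ f F w) : u = w := by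
  obtain ⟨b, hb⟩ := exists_L2_comp hβ_cont hgrowth u
  obtain ⟨b', hb'⟩ := exists_L2_comp hβ_cont hgrowth w
  obtain ⟨z, hz, hzu, hz2⟩ := hu
  obtain ⟨z', hz', hzw, hz2'⟩ := hw
  have key : ∀ v ∈ H10 Ω, inner ℝ (b - b') v.1 + a (z.2 - z'.2) v.2 = 0 := fun v hv => by
    have h1 := hz2 v hv
    have h2 := hz2' v hv
    rw [integral_comp_mul_eq_inner hb, ha] at h1
    rw [integral_comp_mul_eq_inner hb', ha] at h2
    rw [inner_sub_left, map_sub, sub_apply]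
    linarith
  have hgrad : z.2 - z'.2 = 0 := by
    have h1 := key (z - z') ((H10 Ω).sub_mem hz hz')
    have h2 := inner_nonneg_of_monotone hζ hβ hzu hzw hb hb'
    have h3 := hcoer (z.2 - z'.2)
    rw [Prod.fst_sub, Prod.snd_sub] at h1
    have h4 : lam * ‖z.2 - z'.2‖ ^ 2 ≤ 0 := by linarith
    have h5 : ‖z.2 - z'.2‖ ^ 2 ≤ 0 := nonpos_of_mul_nonpos_right h4 hlam
    exact norm_eq_zero.1 (pow_eq_zero_iff two_ne_zero |>.1 (le_antisymm h5 (sq_nonneg _)))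
  have hzz : z.1 = z'.1 := sub_eq_zero.1 (hpoincare (z - z') ((H10 Ω).sub_mem hz hz') hgrad)
  have hbb : b = b' := by
    refine sub_eq_zero.1 (eq_zero_of_forall_inner_H10 hΩ fun v hv => ?_)
    have h1 := key v hv
    rwa [hgrad, map_zero, zero_apply, add_zero] at h1
  subst hbb
  refine Lp.ext ?_
  rw [hzz] at hzu
  filter_upwards [hb, hb', hzu, hzw] with x h1 h2 h3 h4
  refine hβζ.injective ?_
  rw [← h1, ← h2, ← h3, ← h4]

end WeakSolution

/-! ## Solutions of the scheme -/

section Scheme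

variable {d : ℕ} {Ω : Set (Rd d)} {β ζ : ℝ → ℝ} {Λ : Rd d → Matrix (Fin d) (Fin d) ℝ}
  {f : L2 Ω} {F : L2Vec Ω} {a : L2Vec Ω →L[ℝ] L2Vec Ω →L[ℝ] ℝ}

lemma IsSchemeSolution.inner_eq (hΩ : MeasurableSet Ω)
    (ha : ∀ G H, diffusionForm Λ G H = a G H) (hζ0 : ζ 0 = 0) (hβ0 : β 0 = 0)
    {I : Type*} [Fintype I] {B : Set I} {D : GradientDiscretisation Ω (nodalSpace B)}
    (hD : IsPiecewiseConstant D) {u : nodalSpace B}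
    (hu : IsSchemeSolution D β ζ hζ0 Λ f F u) (v : nodalSpace B) :
    inner ℝ (D.recon (nodalMap β hβ0 u)) (D.recon v) + a (D.grad (nodalMap ζ hζ0 u)) (D.grad v)
      = inner ℝ (D.quad f) (D.recon v) - inner ℝ F (D.grad v) := by
  have h := hu v
  rw [integral_comp_mul_eq_inner (hD.recon_nodalMap_ae hΩ hβ0 u), ha, integral_mul_eq_inner,
    ← L2.inner_def] at h
  exact h

lemma IsSchemeSolution.norm_grad_le (hΩ : MeasurableSet Ω) (hζ : Monotone ζ) (hβ : Monotone β)
    (ha : ∀ G H, diffusionForm Λ G H = a G H) {lam : ℝ} (hlam : 0 < lam)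
    (hcoer : ∀ G, lam * ‖G‖ ^ 2 ≤ a G G) (hζ0 : ζ 0 = 0) (hβ0 : β 0 = 0)
    {I : Type*} [Fintype I] {B : Set I} {D : GradientDiscretisation Ω (nodalSpace B)}
    (hD : IsPiecewiseConstant D) {u : nodalSpace B}
    (hu : IsSchemeSolution D β ζ hζ0 Λ f F u) {C q : ℝ} (hC : D.coercivityConst ≤ C)
    (hq : ‖D.quad f‖ ≤ q) :
    ‖D.grad (nodalMap ζ hζ0 u)‖ ≤ (q * C + ‖F‖) / lam := by
  set g := D.grad (nodalMap ζ hζ0 u)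
  set z := D.recon (nodalMap ζ hζ0 u)
  have h1 : _ + a g g = inner ℝ (D.quad f) z - _ := hu.inner_eq hΩ ha hζ0 hβ0 hD _
  have hz : ∀ᵐ x ∂(volume.restrict Ω), z x = ζ (D.recon u x) := hD.recon_nodalMap_ae hΩ hζ0 u
  have h2 : 0 ≤ inner ℝ (D.recon (nodalMap β hβ0 u)) z := by
    rw [← integral_mul_eq_inner]
    refine integral_nonneg_of_ae ?_
    filter_upwards [hz, hD.recon_nodalMap_ae hΩ hβ0 u] with x h3 h4
    rw [h3, h4]
    simpa [hζ0, hβ0] using mul_nonneg_of_monotone hβ hζ (D.recon u x) 0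
  have h3 : ‖z‖ ≤ C * ‖g‖ := (D.norm_recon_le _).trans (by gcongr)
  have h4 : inner ℝ (D.quad f) z ≤ q * (C * ‖g‖) :=
    (real_inner_le_norm _ _).trans (by gcongr; exact (norm_nonneg _).trans hq)
  have h5 : -(‖F‖ * ‖g‖) ≤ inner ℝ F g := (abs_le.1 (abs_real_inner_le_norm F g)).1
  have h6 : lam * ‖g‖ ^ 2 ≤ (q * C + ‖F‖) * ‖g‖ := by linarith [hcoer g]
  rw [le_div_iff₀ hlam]
  rcases (norm_nonneg g).eq_or_lt with h0 | h0
  · rw [← h0, zero_mul]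
    rcases le_or_gt 0 C with hC0 | hC0
    · have := (norm_nonneg _).trans hq
      positivity
    · exact absurd (D.coercivityConst_nonneg.trans hC) (not_le.2 hC0)
  · exact le_of_mul_le_mul_right (by linarith) h0

end Scheme

/-- Convergence of the scheme along an ultrafilter. -/
lemma exists_limit {d : ℕ} {Ω : Set (Rd d)} [IsFiniteMeasure (volume.restrict Ω)]
    (hΩ : IsOpen Ω) {ζ β : ℝ → ℝ}
    (hζ_cont : Continuous ζ) (hβ_cont : Continuous β) (hζ : Monotone ζ)
    (hβ : Monotone β) (hζ0 : ζ 0 = 0) (hβ0 : β 0 = 0) {M₀ M₁ : ℝ} (hM₀ : 0 < M₀) (hM₁ : 0 ≤ M₁)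
    (hζ_growth : ∀ s : ℝ, M₀ * |s| - M₁ ≤ |ζ s|) {K₀ K₁ : ℝ} (hK₀ : 0 ≤ K₀) (hK₁ : 0 ≤ K₁)
    (hβ_growth : ∀ s : ℝ, |β s| ≤ K₀ * |s| + K₁) (hβζ : StrictMono (fun s => β s + ζ s))
    {Λ : Rd d → Matrix (Fin d) (Fin d) ℝ} {f : L2 Ω} {F : L2Vec Ω}
    {a : L2Vec Ω →L[ℝ] L2Vec Ω →L[ℝ] ℝ}
    (ha : ∀ G H, diffusionForm Λ G H = a G H) {lam : ℝ} (hlam : 0 < lam)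
    (hacoer : ∀ G, lam * ‖G‖ ^ 2 ≤ a G G)
    {I : ℕ → Type*} [∀ m, Fintype (I m)] {B : ∀ m, Set (I m)}
    {D : ∀ m, GradientDiscretisation Ω (nodalSpace (B m))}
    (hpc : ∀ m, IsPiecewiseConstant (D m)) {C : ℝ} (hcoer : ∀ m, (D m).coercivityConst ≤ C)
    (hcons : ∀ φ ∈ H10 Ω, Tendsto (fun m => (D m).interpError φ) atTop (𝓝 0))
    (hquad : Tendsto (fun m => ‖(D m).quad f - f‖) atTop (𝓝 0))
    (hconf : ∀ (ψ : L2Vec Ω) (δ : L2 Ω), HasWeakDivergence ψ δ →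
      Tendsto (fun m => (D m).conformityDefect ψ δ) atTop (𝓝 0))
    (hcomp : ∀ v : ∀ m, nodalSpace (B m), (∃ C : ℝ, ∀ m, ‖(D m).grad (v m)‖ ≤ C) →
      IsCompact (closure (Set.range fun m => (D m).recon (v m))))
    {u : ∀ m, nodalSpace (B m)} (hu : ∀ m, IsSchemeSolution (D m) β ζ hζ0 Λ f F (u m))
    {l : Ultrafilter ℕ} (hl : (l : Filter ℕ) ≤ atTop) :
    ∃ ubar : L2 Ω, ∃ z ∈ H10 Ω, ∃ b : L2 Ω, IsWeakSolution Ω β ζ Λ f F ubar ∧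
      (∀ᵐ x ∂(volume.restrict Ω), z.1 x = ζ (ubar x)) ∧
      (∀ᵐ x ∂(volume.restrict Ω), b x = β (ubar x)) ∧
      Tendsto (fun m => (D m).recon (nodalMap ζ hζ0 (u m))) l (𝓝 z.1) ∧
      Tendsto (fun m => (D m).grad (nodalMap ζ hζ0 (u m))) l (𝓝 z.2) ∧
      ∀ y, Tendsto (fun m => inner ℝ ((D m).recon (nodalMap β hβ0 (u m))) y) l
        (𝓝 (inner ℝ b y)) := by
  have hΩm := hΩ.measurableSet
  have hquad' := tendsto_iff_norm_sub_tendsto_zero.2 hquad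
  obtain ⟨q, hq⟩ := (Metric.isBounded_range_of_tendsto _ hquad').exists_norm_le
  have hbound : ∀ m, ‖(D m).grad (nodalMap ζ hζ0 (u m))‖ ≤ (q * C + ‖F‖) / lam := fun m =>
    (hu m).norm_grad_le hΩm hζ hβ ha hlam hacoer hζ0 hβ0 (hpc m) (hcoer m) (hq _ ⟨m, rfl⟩)
  set g := fun m => (D m).grad (nodalMap ζ hζ0 (u m))
  set Z := fun m => (D m).recon (nodalMap ζ hζ0 (u m))
  set b := fun m => (D m).recon (nodalMap β hβ0 (u m))
  set R := (q * C + ‖F‖) / lam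
  have hZae : ∀ m, ∀ᵐ x ∂(volume.restrict Ω), Z m x = ζ ((D m).recon (u m) x) := fun m =>
    (hpc m).recon_nodalMap_ae hΩm hζ0 (u m)
  have hbae : ∀ m, ∀ᵐ x ∂(volume.restrict Ω), b m x = β ((D m).recon (u m) x) := fun m =>
    (hpc m).recon_nodalMap_ae hΩm hβ0 (u m)
  have hC : 0 ≤ C := (D 0).coercivityConst_nonneg.trans (hcoer 0)
  have hZbound : ∀ m, ‖Z m‖ ≤ C * R := fun m =>
    ((D m).norm_recon_le _).trans (mul_le_mul (hcoer m) (hbound m) (norm_nonneg _) hC)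
  obtain ⟨Rb, hbbound⟩ : ∃ Rb, ∀ m, ‖b m‖ ≤ Rb := by
    refine ⟨K₀ / M₀ * (C * R) + (K₀ / M₀ * M₁ + K₁) * ‖Lp.const 2 (volume.restrict Ω) (1 : ℝ)‖,
      fun m => ?_⟩
    refine (norm_le_of_ae_le_affine (k := Z m) (A := K₀ / M₀) (B := K₀ / M₀ * M₁ + K₁)
      (by positivity) (by positivity) ?_).trans (by gcongr; exact hZbound m)
    filter_upwards [hZae m, hbae m] with x h1 h2
    rw [h1, h2]
    set s := (D m).recon (u m) x
    have h3 : |s| ≤ (|ζ s| + M₁) / M₀ := by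
      rw [le_div_iff₀ hM₀]
      linarith [hζ_growth s]
    calc |β s| ≤ K₀ * |s| + K₁ := hβ_growth s
      _ ≤ K₀ * ((|ζ s| + M₁) / M₀) + K₁ := by gcongr
      _ = _ := by ring
  obtain ⟨Z₀, -, hZ₀⟩ := isCompact_iff_ultrafilter_le_nhds.1 (hcomp _ ⟨R, hbound⟩) (l.map Z) (by
    rw [le_principal_iff, Ultrafilter.mem_coe, Ultrafilter.mem_map]
    exact Filter.mem_of_superset Filter.univ_mem fun m _ => subset_closure ⟨m, rfl⟩)
  have hZlim : Tendsto Z l (𝓝 Z₀) := hZ₀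
  obtain ⟨G, hG⟩ := exists_weak_limit_of_bounded l hbound
  obtain ⟨b₀, hb₀⟩ := exists_weak_limit_of_bounded l hbbound
  have hmem : (Z₀, G) ∈ H10 Ω :=
    GradientDiscretisation.mem_H10_of_tendsto hconf hl hbound hZlim hG
  obtain ⟨ubar, hζu, hβu⟩ := exists_eq_of_tendsto hζ_cont hβ_cont hζ hβ hζ0 hβ0 hM₀ hζ_growth hβζ
    hZae hbae hbbound hZlim hb₀
  have hscheme := fun m => (hu m).inner_eq hΩm ha hζ0 hβ0 (hpc m)
  have hQ : Tendsto (fun m => (D m).quad f) l (𝓝 f) := hquad'.mono_left hl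
  have hweak : ∀ v ∈ H10 Ω, inner ℝ b₀ v.1 + a G v.2 = inner ℝ f v.1 - inner ℝ F v.2 := by
    intro v hv
    obtain ⟨w, hw1, hw2⟩ := GradientDiscretisation.exists_interp_tendsto (hcons v hv)
    replace hw1 := hw1.mono_left hl
    replace hw2 := hw2.mono_left hl
    have h1 := (tendsto_inner_of_weak_of_strong hbbound hb₀ hw1).add
      (tendsto_bilin_of_weak_of_strong a hbound hG hw2)
    have h2 := (hQ.inner (𝕜 := ℝ) hw1).sub ((tendsto_const_nhds (x := F)).inner (𝕜 := ℝ) hw2)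
    exact tendsto_nhds_unique (h1.congr fun m => hscheme m (w m)) h2
  have hFg : Tendsto (fun m => inner ℝ F (g m)) l (𝓝 (inner ℝ F G)) := by
    simpa only [real_inner_comm F] using hG F
  have hagg : Tendsto (fun m => a (g m) (g m)) l (𝓝 (a G G)) := by
    have h1 := ((hQ.inner (𝕜 := ℝ) hZlim).sub hFg).sub
      (tendsto_inner_of_weak_of_strong hbbound hb₀ hZlim)
    rw [← hweak _ hmem, add_sub_cancel_left] at h1
    refine h1.congr fun m => ?_
    rw [← hscheme m (nodalMap ζ hζ0 (u m)), add_sub_cancel_left]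
  have hglim : Tendsto g l (𝓝 G) := by
    rw [tendsto_iff_norm_sub_tendsto_zero]
    have h1 : Tendsto (fun m => a (g m) G) l (𝓝 (a G G)) :=
      tendsto_bilin_of_weak_of_strong a hbound hG tendsto_const_nhds
    have h2 : Tendsto (fun m => a G (g m)) l (𝓝 (a G G)) :=
      tendsto_bilin_of_weak_of_strong a.flip hbound hG tendsto_const_nhds
    have h3 : Tendsto (fun m => (a (g m) (g m) - a (g m) G - (a G (g m) - a G G)) / lam) l
        (𝓝 0) := by
      simpa using ((hagg.sub h1).sub (h2.sub_const (a G G))).div_const lam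
    have h4 : Tendsto (fun m => ‖g m - G‖ ^ 2) l (𝓝 0) := by
      refine squeeze_zero (fun m => sq_nonneg _) (fun m => ?_) h3
      rw [le_div_iff₀ hlam, mul_comm]
      refine (hacoer _).trans_eq ?_
      simp only [map_sub, sub_apply]
      ring
    simpa using h4.sqrt
  exact ⟨ubar, (Z₀, G), hmem, b₀, isWeakSolution_of_inner ha hmem hζu hβu hweak, hζu, hβu, hZlim,
    hglim, hb₀⟩

end GradScheme

open GradScheme in
theorem mainTheorem3
    -- the domain
    {d : ℕ} (hd : 1 ≤ d) (Ω : Set (Rd d)) (hΩ_open : IsOpen Ω)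
    (hΩ_bdd : Bornology.IsBounded Ω) (hΩ_conn : IsPreconnected Ω)
    -- the nonlinearities
    (ζ β : ℝ → ℝ)
    (hζ_cont : Continuous ζ) (hζ_mono : Monotone ζ) (hζ0 : ζ 0 = 0)
    (hζ_growth : ∃ M₀ > (0 : ℝ), ∃ M₁ > (0 : ℝ), ∀ s : ℝ, M₀ * |s| - M₁ ≤ |ζ s|)
    (hβ_cont : Continuous β) (hβ_mono : Monotone β) (hβ0 : β 0 = 0)
    (hβ_growth : ∃ K₀ > (0 : ℝ), ∃ K₁ > (0 : ℝ), ∀ s : ℝ, |β s| ≤ K₀ * |s| + K₁)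
    (hβζ : StrictMono (fun s => β s + ζ s))
    -- the diffusion tensor
    (Λ : Rd d → Matrix (Fin d) (Fin d) ℝ)
    (hΛ_meas : ∀ i j, AEMeasurable (fun x => Λ x i j) (volume.restrict Ω))
    (hΛ : ∃ lam Lam : ℝ, 0 < lam ∧ lam ≤ Lam ∧ ∀ᵐ x ∂(volume.restrict Ω),
      (Λ x).IsSymm ∧ spectrum ℝ (Λ x) ⊆ Set.Icc lam Lam)
    -- the source terms
    (f : L2 Ω) (F : L2Vec Ω)
    -- the gradient discretisations
    (I : ℕ → Type*) [∀ m, Fintype (I m)] (B : ∀ m, Set (I m))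
    (D : ∀ m, GradientDiscretisation Ω (nodalSpace (B m)))
    (hpc : ∀ m, IsPiecewiseConstant (D m))
    -- coercivity
    (hcoer : ∃ C : ℝ, ∀ m, (D m).coercivityConst ≤ C)
    -- consistency
    (hcons : ∀ φ ∈ H10 Ω, Tendsto (fun m => (D m).interpError φ) atTop (𝓝 0))
    (hquad : Tendsto (fun m => ‖(D m).quad f - f‖) atTop (𝓝 0))
    -- limit-conformity
    (hconf : ∀ (ψ : L2Vec Ω) (δ : L2 Ω), HasWeakDivergence ψ δ →
      Tendsto (fun m => (D m).conformityDefect ψ δ) atTop (𝓝 0))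
    -- compactness
    (hcomp : ∀ v : ∀ m, nodalSpace (B m), (∃ C : ℝ, ∀ m, ‖(D m).grad (v m)‖ ≤ C) →
      IsCompact (closure (Set.range fun m => (D m).recon (v m))))
    -- solutions of the scheme
    (u : ∀ m, nodalSpace (B m))
    (hu : ∀ m, IsSchemeSolution (D m) β ζ hζ0 Λ f F (u m)) :
    ∃ ubar : L2 Ω, IsWeakSolution Ω β ζ Λ f F ubar ∧
      (∀ w : L2 Ω, IsWeakSolution Ω β ζ Λ f F w → w = ubar) ∧
      -- `z` is the pair `(ζ(ubar), ∇ζ(ubar))` and `b` is `β(ubar)`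
      ∃ z ∈ H10 Ω, ∃ b : L2 Ω,
        (∀ᵐ x ∂(volume.restrict Ω), z.1 x = ζ (ubar x)) ∧
        (∀ᵐ x ∂(volume.restrict Ω), b x = β (ubar x)) ∧
        Tendsto (fun m => (D m).recon (nodalMap ζ hζ0 (u m))) atTop (𝓝 z.1) ∧
        Tendsto (fun m => (D m).grad (nodalMap ζ hζ0 (u m))) atTop (𝓝 z.2) ∧
        Tendsto (fun m => toWeakSpace ℝ (L2 Ω) ((D m).recon (nodalMap β hβ0 (u m)))) atTop
          (𝓝 (toWeakSpace ℝ (L2 Ω) b)) := by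
  obtain ⟨M₀, hM₀, M₁, hM₁, hζ_growth⟩ := hζ_growth
  obtain ⟨K₀, hK₀, K₁, hK₁, hβ_growth⟩ := hβ_growth
  obtain ⟨lam, Lam, hlam, -, hΛ⟩ := hΛ
  obtain ⟨C, hcoer⟩ := hcoer
  obtain ⟨a, ha, hacoer⟩ := exists_diffusion_bilin hΛ_meas hlam.le hΛ
  have : IsFiniteMeasure (volume.restrict Ω) :=
    isFiniteMeasure_restrict.2 hΩ_bdd.measure_lt_top.ne
  have hlimit := fun (l : Ultrafilter ℕ) (hl : (l : Filter ℕ) ≤ atTop) =>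
    exists_limit hΩ_open hζ_cont hβ_cont hζ_mono hβ_mono hζ0 hβ0 hM₀ hM₁.le hζ_growth hK₀.le
      hK₁.le hβ_growth hβζ ha hlam hacoer hpc hcoer hcons hquad hconf hcomp hu hl
  have huniq : ∀ u w : L2 Ω, IsWeakSolution Ω β ζ Λ f F u → IsWeakSolution Ω β ζ Λ f F w →
      u = w := fun u w hu hw =>
    IsWeakSolution.unique hΩ_open hβ_cont hζ_mono hβ_mono hβ_growth hβζ ha hlam hacoer
      (fun p hp => GradientDiscretisation.eq_zero_of_gradient_eq_zero hcoer (hcons p hp)) hu hw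
  obtain ⟨ubar, z, hz, b, hsol, hzu, hbu, -⟩ := hlimit (Ultrafilter.of atTop)
    (Ultrafilter.of_le _)
  have hconv : ∀ l : Ultrafilter ℕ, (l : Filter ℕ) ≤ atTop →
      Tendsto (fun m => (D m).recon (nodalMap ζ hζ0 (u m))) l (𝓝 z.1) ∧
      Tendsto (fun m => (D m).grad (nodalMap ζ hζ0 (u m))) l (𝓝 z.2) ∧
      Tendsto (fun m => toWeakSpace ℝ (L2 Ω) ((D m).recon (nodalMap β hβ0 (u m)))) l
          (𝓝 (toWeakSpace ℝ (L2 Ω) b)) := by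
    intro l hl
    obtain ⟨ubar', z', hz', b', hsol', hzu', hbu', h1, h2, h3⟩ := hlimit l hl
    obtain rfl := huniq _ _ hsol hsol'
    have hz1 : z'.1 = z.1 := Lp.ext (by
      filter_upwards [hzu, hzu'] with x e e'
      rw [e, e'])
    have hb1 : b' = b := Lp.ext (by
      filter_upwards [hbu, hbu'] with x e e'
      rw [e, e'])
    have hz2 : z'.2 = z.2 := H10.gradient_unique hΩ_open hz' hz hz1
    rw [← hz1, ← hz2, ← hb1]
    exact ⟨h1, h2, tendsto_toWeakSpace_of_inner h3⟩
  exact ⟨ubar, hsol, fun w hw => huniq _ _ hw hsol, z, hz, b, hzu, hbu,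
    (tendsto_iff_ultrafilter _ _ _).2 fun l hl => (hconv l hl).1,
    (tendsto_iff_ultrafilter _ _ _).2 fun l hl => (hconv l hl).2.1,
    (tendsto_iff_ultrafilter _ _ _).2 fun l hl => (hconv l hl).2.2⟩
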